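/- Let $\mathbb F$ be an algebraically closed field, $V$ a vector space over $\mathbb F$ of finite positive dimension, $d\ge 3$, and let $\Phi=(A;\{E_i\}_{i=0}^d;A^*;\{E^*_i\}_{i=0}^d)$ be a Leonard system on $V$. That is: $A,A^*$ is a Leonard pair on $V$ (there is a basis of $V$ in which $A$ is irreducible tridiagonal and $A^*$ is diagonal, and a basis in which $A^*$ is irreducible tridiagonal and $A$ is diagonal); $E_i$ is the primitive idempotent of $A$ (projection onto an eigenspace) for the eigenvalue $\theta_i$, where $\theta_0,\dots,\theta_d$ are the distinct eigenvalues of $A$, ordered so that in a basis of corresponding eigenvectors $A^*$ is irreducible tridiagonal; and likewise for $E^*_i,\theta^*_i$ with $A$ and $A^*$ exchanged. Let $\tau_i(x)=(x-\theta_0)\cdots(x-\theta_{i-1})$ and $0\ne u\in E_0^*V$. The vectors $\tau_i(A)u$ $(0\le i\le d)$ form a basis of $V$; with rows and columns numbered from $0$ to $d$, let $\varphi_i$ $(1\le i\le d)$ be the $(i-1,i)$-entry of the matrix of $A^*$ in this basis (it does not depend on $u$). Let $\phi_i$ be the corresponding scalar for the Leonard system $(A;\{E_{d-i}\}_{i=0}^d;A^*;\{E^*_i\}_{i=0}^d)$.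 Put $a_i=\mathrm{tr}(E^*_iA)$, and let $\mathcal Z(\Phi)$ be the space of all $X\in\mathrm{Span}\{I,A^*,A,AA^*\}$ with $E^*_iXE^*_i=0$ for $0\le i\le d$. Write $$P=(A-a_0I)(A^*-\theta^*_dI),\qquad Q=(A-a_dI)(A^*-\theta^*_0I).$$ The types of $\Phi$ are as follows. In each of them the equations for $\theta_i,\theta_i^*$ hold for $0\le i\le d$ and those for $\varphi_i,\phi_i$ for $1\le i\le d$; all parameters are scalars in $\mathbb F$. * $q$-Racah, parameters $q,h,h^*,s,s^*,r_1,r_2$, all nonzero: $r_1r_2=ss^*q^{d+1}$; none of $q^i,r_1q^i,r_2q^i,s^*q^i/r_1,s^*q^i/r_2$ is $1$ for $1\le i\le d$; $sq^i\ne1$, $s^*q^i\neq 1$ for $2\le i\le 2d$; $\theta_i=\theta_0+h(1-q^i)(1-sq^{i+1})q^{-i}$; $\theta^*_i=\theta^*_0+h^*(1-q^i)(1-s^*q^{i+1})q^{-i}$; $\varphi_i=hh^*q^{1-2i}(1-q^i)(1-q^{i-d-1})(1-r_1q^i)(1-r_2q^i)$; $\phi_i=hh^*q^{1-2i}(1-q^i)(1-q^{i-d-1})(r_1-s^*q^i)(r_2-s^*q^i)/s^*$.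 * $q$-Hahn, parameters $q,h,h^*,s^*,r$, all nonzero: none of $q^i,rq^i,s^*q^i/r$ is $1$ for $1\le i\le d$; $s^*q^i\ne1$ for $2\le i\le2d$; $\theta_i=\theta_0+h(1-q^i)q^{-i}$; $\theta_i^*=\theta_0^*+h^*(1-q^i)(1-s^*q^{i+1})q^{-i}$; $\varphi_i=hh^*q^{1-2i}(1-q^i)(1-q^{i-d-1})(1-rq^i)$; $\phi_i=-hh^*q^{1-i}(1-q^i)(1-q^{i-d-1})(r-s^*q^i)$. * Dual $q$-Krawtchouk, parameters $q,h,h^*,s$, all nonzero: $q^i\ne1$ for $1\le i\le d$; $sq^i\ne1$ for $2\le i\le2d$; $\theta_i=\theta_0+h(1-q^i)(1-sq^{i+1})q^{-i}$; $\theta_i^*=\theta_0^*+h^*(1-q^i)q^{-i}$; $\varphi_i=hh^*q^{1-2i}(1-q^i)(1-q^{i-d-1})$; $\phi_i=hh^*sq^{d+2-2i}(1-q^i)(1-q^{i-d-1})$. * Racah, parameters $h,h^*,s,s^*,r_1,r_2$ with $h,h^*\neq0$: $r_1+r_2=s+s^*+d+1$; $\mathrm{char}\,\mathbb F$ is $0$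 or a prime greater than $d$; none of $r_1,r_2,s^*-r_1,s^*-r_2$ is $-i$ for $1\le i\le d$; $s\ne-i$, $s^*\neq-i$ for $2\le i\le2d$; $\theta_i=\theta_0+hi(i+1+s)$; $\theta_i^*=\theta_0^*+h^*i(i+1+s^*)$; $\varphi_i=hh^*i(i-d-1)(i+r_1)(i+r_2)$; $\phi_i=hh^*i(i-d-1)(i+s^*-r_1)(i+s^*-r_2)$. * Hahn, parameters $h^*,s,s^*,r$ with $h^*,s\ne0$: $\mathrm{char}\,\mathbb F$ is $0$ or a prime greater than $d$; neither of $r,s^*-r$ is $-i$ for $1\le i\le d$; $s^*\ne-i$ for $2\le i\le2d$; $\theta_i=\theta_0+si$; $\theta^*_i=\theta^*_0+h^*i(i+1+s^*)$; $\varphi_i=h^*si(i-d-1)(i+r)$; $\phi_i=-h^*si(i-d-1)(i+s^*-r)$. * Krawtchouk, parameters $s,s^*,r$, all nonzero: $\mathrm{char}\,\mathbb F$ is $0$ or a prime greater than $d$; $r\neq ss^*$; $\theta_i=\theta_0+si$; $\theta_i^*=\theta_0^*+s^*i$; $\varphi_i=ri(i-d-1)$; $\phi_i=(r-ss^*)i(i-d-1)$.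 * Bannai/Ito, parameters $h,h^*,s,s^*,r_1,r_2$ with $h,h^*\ne0$: $\mathrm{char}\,\mathbb F$ is $0$ or an odd prime greater than $d/2$; $r_1+r_2=-s-s^*+d+1$; neither of $r_1,-s^*-r_1$ is $-i$ for $1\le i\le d$ with $d-i$ even; neither of $r_2,-s^*-r_2$ is $-i$ for $1\le i\le d$ with $i$ odd; neither of $s,s^*$ is $2i$ for $1\le i\le d$; $\theta_i=\theta_0+h(s-1+(1-s+2i)(-1)^i)$; $\theta^*_i=\theta^*_0+h^*(s^*-1+(1-s^*+2i)(-1)^i)$; for $d$ even, $\varphi_i=-4hh^*i(i+r_1)$, $\phi_i=4hh^*i(i-s^*-r_1)$ if $i$ is even, and $\varphi_i=-4hh^*(i-d-1)(i+r_2)$, $\phi_i=4hh^*(i-d-1)(i-s^*-r_2)$ if $i$ is odd; for $d$ odd, $\varphi_i=\phi_i=-4hh^*i(i-d-1)$ if $i$ is even, and $\varphi_i=-4hh^*(i+r_1)(i+r_2)$, $\phi_i=-4hh^*(i-s^*-r_1)(i-s^*-r_2)$ if $i$ is odd. **Proposition.** Assume $\mathcal Z(\Phi)\ne0$. In each of the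 following cases (where $\Phi$ has the named type with the given parameters), the given element is nonzero and contained in $\mathcal Z(\Phi)$; moreover, it is a basis of $\mathcal Z(\Phi)$ provided that $\dim\mathcal Z(\Phi)=1$. 1. $q$-Racah, $s^*=r_1^2$: $\;q^d(r_1+1)(r_1q+1)P-(r_1q^d+1)(r_1q^{d+1}+1)Q$. 2. $q$-Racah, $s^*=r_2^2$: $\;q^d(r_2+1)(r_2q+1)P-(r_2q^d+1)(r_2q^{d+1}+1)Q$. 3. $q$-Hahn, $s^*=r^2$: $\;q^d(r+1)(rq+1)P-(rq^d+1)(rq^{d+1}+1)Q$. 4. Dual $q$-Krawtchouk: $\;q^dP-Q$. 5. Racah, $s^*=2r_1$: $\;P-Q$. 6. Racah, $s^*=2r_2$: $\;P-Q$. 7. Hahn: $\;s^*(s^*+2)P-(s^*+2d)(s^*+2d+2)Q$. 8. Krawtchouk: $\;P-Q$. 9. Bannai/Ito, $d$ even, $s^*=-2r_1$: $\;(r_1+1)P-(r_1+d+1)Q$. 10. Bannai/Ito, $d$ even, $s^*=-2r_2$: $\;r_2P-(r_2+d)Q$. 11. Bannai/Ito, $d$ odd, $s^*=-2r_1$: $\;r_1P+(r_1+d+1)Q$.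 12. Bannai/Ito, $d$ odd, $s^*=-2r_2$: $\;r_2P+(r_2+d+1)Q$. -/

import Mathlib

/-- A square matrix is irreducible tridiagonal if its nonzero entries lie on the diagonal,
the subdiagonal or the superdiagonal, and every entry on the subdiagonal and on the
superdiagonal is nonzero. -/
def IsIrreducibleTridiagonal {F : Type*} [Field F] {n : ℕ} (M : Matrix (Fin n) (Fin n) F) :
    Prop :=
  (∀ i j : Fin n, ((i : ℕ) + 1 < j ∨ (j : ℕ) + 1 < i) → M i j = 0) ∧
    (∀ i j : Fin n, ((i : ℕ) + 1 = j ∨ (j : ℕ) + 1 = i) → M i j ≠ 0)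

/-- `A, As` is a Leonard pair on `V` (`As` stands for the map `A^*`). -/
def IsLeonardPair {F V : Type*} [Field F] [AddCommGroup V] [Module F V]
    (A As : Module.End F V) : Prop :=
  (∃ (n : ℕ) (b : Module.Basis (Fin n) F V),
    IsIrreducibleTridiagonal (LinearMap.toMatrix b b A) ∧ (LinearMap.toMatrix b b As).IsDiag) ∧
  (∃ (n : ℕ) (b : Module.Basis (Fin n) F V),
    IsIrreducibleTridiagonal (LinearMap.toMatrix b b As) ∧ (LinearMap.toMatrix b b A).IsDiag)

/-- `P` is the projection onto the `μ`-eigenspace of `A` that vanishes on the other eigenspaces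
of `A`; for a multiplicity-free `A` with eigenvalue `μ`, this is the primitive idempotent of `A`
associated with `μ`. -/
def IsPrimitiveIdempotent {F V : Type*} [Field F] [AddCommGroup V] [Module F V]
    (A : Module.End F V) (μ : F) (P : Module.End F V) : Prop :=
  (∀ v ∈ A.eigenspace μ, P v = v) ∧ (∀ ν : F, ν ≠ μ → ∀ v ∈ A.eigenspace ν, P v = 0)

/-- `θ_0, …, θ_d` is a standard ordering of the eigenvalues of `A`, with respect to `As`: it lists
the eigenvalues of `A` without repetition, and corresponding eigenvectors `v_0, …, v_d` form
a basis of `V` with respect to which `As` is irreducible tridiagonal (and `A` is diagonal). -/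
def IsStandardEigenvalueOrdering {F V : Type*} [Field F] [AddCommGroup V] [Module F V] {d : ℕ}
    (A As : Module.End F V) (θ : Fin (d + 1) → F) : Prop :=
  Function.Injective θ ∧ (∀ μ : F, A.HasEigenvalue μ ↔ ∃ i, θ i = μ) ∧
    ∃ v : Module.Basis (Fin (d + 1)) F V,
      (∀ i, A (v i) = θ i • v i) ∧ IsIrreducibleTridiagonal (LinearMap.toMatrix v v As)

/-- A Leonard system `(A; {E_i}; A^*; {E^*_i})` of diameter `d` on `V`. -/
structure LeonardSystem (F V : Type*) [Field F] [AddCommGroup V] [Module F V] (d : ℕ) where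
  /-- the map `A` -/
  A : Module.End F V
  /-- the primitive idempotents `E_i` of `A` -/
  E : Fin (d + 1) → Module.End F V
  /-- the map `A^*` -/
  As : Module.End F V
  /-- the primitive idempotents `E^*_i` of `A^*` -/
  Es : Fin (d + 1) → Module.End F V
  isLeonardPair : IsLeonardPair A As
  isStandard_E : ∃ θ : Fin (d + 1) → F, IsStandardEigenvalueOrdering A As θ ∧
    ∀ i, IsPrimitiveIdempotent A (θ i) (E i)
  isStandard_Es : ∃ θ : Fin (d + 1) → F, IsStandardEigenvalueOrdering As A θ ∧
    ∀ i, IsPrimitiveIdempotent As (θ i) (Es i)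

namespace LeonardSystem

section Basic

variable {F V : Type*} [Field F] [AddCommGroup V] [Module F V] {d : ℕ}

/-- The eigenvalue sequence: `Φ.th i` is the eigenvalue of `A` associated with `E_i`. -/
noncomputable def th (Φ : LeonardSystem F V d) : Fin (d + 1) → F :=
  Φ.isStandard_E.choose

/-- The dual eigenvalue sequence: `Φ.ths i` is the eigenvalue of `A^*` associated with `E^*_i`. -/
noncomputable def ths (Φ : LeonardSystem F V d) : Fin (d + 1) → F :=
  Φ.isStandard_Es.choose

theorem th_spec (Φ : LeonardSystem F V d) : IsStandardEigenvalueOrdering Φ.A Φ.As Φ.th ∧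
    ∀ i, IsPrimitiveIdempotent Φ.A (Φ.th i) (Φ.E i) :=
  Φ.isStandard_E.choose_spec

theorem ths_spec (Φ : LeonardSystem F V d) : IsStandardEigenvalueOrdering Φ.As Φ.A Φ.ths ∧
    ∀ i, IsPrimitiveIdempotent Φ.As (Φ.ths i) (Φ.Es i) :=
  Φ.isStandard_Es.choose_spec

theorem isStandardEigenvalueOrdering_rev {A As : Module.End F V} {θ : Fin (d + 1) → F}
    (h : IsStandardEigenvalueOrdering A As θ) :
    IsStandardEigenvalueOrdering A As (fun i => θ i.rev) := by
  obtain ⟨hinj, heig, v, hv, htri⟩ := h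
  refine ⟨fun i j hij => Fin.rev_injective (hinj hij), fun μ => ?_, v.reindex Fin.revPerm,
    fun i => ?_, ?_⟩
  · rw [heig μ]
    constructor
    · rintro ⟨i, rfl⟩
      exact ⟨i.rev, by simp⟩
    · rintro ⟨i, rfl⟩
      exact ⟨i.rev, rfl⟩
  · simpa using hv i.rev
  · have key : ∀ i j, LinearMap.toMatrix (v.reindex Fin.revPerm) (v.reindex Fin.revPerm) As i j
        = LinearMap.toMatrix v v As i.rev j.rev := by
      intro i j
      simp [LinearMap.toMatrix_apply]
    refine ⟨fun i j hij => ?_, fun i j hij => ?_⟩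
    · rw [key]
      refine htri.1 _ _ ?_
      simp only [Fin.val_rev]
      omega
    · rw [key]
      refine htri.2 _ _ ?_
      simp only [Fin.val_rev]
      omega

/-- The Leonard system `(A; {E_{d-i}}; A^*; {E^*_i})`. -/
def flip (Φ : LeonardSystem F V d) : LeonardSystem F V d where
  A := Φ.A
  E := fun i => Φ.E i.rev
  As := Φ.As
  Es := Φ.Es
  isLeonardPair := Φ.isLeonardPair
  isStandard_E := ⟨fun i => Φ.th i.rev, isStandardEigenvalueOrdering_rev Φ.th_spec.1,
    fun i => Φ.th_spec.2 i.rev⟩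
  isStandard_Es := Φ.isStandard_Es

/-- The polynomial `τ_i(x) = (x - θ_0)(x - θ_1) ⋯ (x - θ_{i-1})`. -/
noncomputable def tau (Φ : LeonardSystem F V d) (i : ℕ) : Polynomial F :=
  ∏ j ∈ Finset.univ.filter (fun j : Fin (d + 1) => (j : ℕ) < i),
    (Polynomial.X - Polynomial.C (Φ.th j))

theorem tau_succ (Φ : LeonardSystem F V d) (i : Fin (d + 1)) :
    Φ.tau ((i : ℕ) + 1) = (Polynomial.X - Polynomial.C (Φ.th i)) * Φ.tau i := by
  have : Finset.univ.filter (fun j : Fin (d + 1) => (j : ℕ) < (i : ℕ) + 1)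
      = insert i (Finset.univ.filter (fun j : Fin (d + 1) => (j : ℕ) < i)) := by
    ext j
    simp only [Finset.mem_filter, Finset.mem_univ, true_and, Finset.mem_insert, Fin.ext_iff]
    omega
  rw [tau, this, Finset.prod_insert (by simp)]
  rfl

/-- The vector `u_i = τ_i(A) u`. -/
noncomputable def splitVector (Φ : LeonardSystem F V d) (u : V) (i : ℕ) : V :=
  Polynomial.aeval Φ.A (Φ.tau i) u

theorem splitVector_isBasis (Φ : LeonardSystem F V d) {u : V}
    (hu : u ∈ LinearMap.range (Φ.Es 0)) (hu0 : u ≠ 0) :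
    LinearIndependent F (fun i : Fin (d + 1) => Φ.splitVector u i) ∧
      Submodule.span F (Set.range (fun i : Fin (d + 1) => Φ.splitVector u i)) = ⊤ := by
  obtain ⟨⟨hinj, -, w, hw, htri⟩, hE⟩ := Φ.ths_spec
  have hEw : ∀ j, j ≠ 0 → Φ.Es 0 (w j) = 0 := fun j hj =>
    (hE 0).2 (Φ.ths j) (fun h => hj (hinj h)) _ (Module.End.mem_eigenspace_iff.2 (hw j))
  have hEw0 : Φ.Es 0 (w 0) = w 0 :=
    (hE 0).1 _ (Module.End.mem_eigenspace_iff.2 (hw 0))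
  obtain ⟨x, rfl⟩ := hu
  have hux : Φ.Es 0 x = w.repr x 0 • w 0 := by
    conv_lhs => rw [← w.sum_repr x]
    rw [map_sum, Finset.sum_eq_single 0]
    · simp [hEw0]
    · intro j _ hj
      simp [hEw j hj]
    · simp
  have hc : w.repr x 0 ≠ 0 := by
    intro h
    exact hu0 (by rw [hux, h, zero_smul])
  have hreprA : ∀ (s : V) (j : Fin (d + 1)),
      w.repr (Φ.A s) j = ∑ k, LinearMap.toMatrix w w Φ.A j k * w.repr s k := by
    intro s j
    have := congrFun (LinearMap.toMatrix_mulVec_repr w w Φ.A s) j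
    rw [← this]
    rfl
  have hind : ∀ (n : ℕ) (hn : n < d + 1),
      (∀ j : Fin (d + 1), n < j → w.repr (Φ.splitVector (Φ.Es 0 x) n) j = 0) ∧
        w.repr (Φ.splitVector (Φ.Es 0 x) n) ⟨n, hn⟩ ≠ 0 := by
    intro n
    induction n with
    | zero =>
      intro hn
      have h0 : Φ.splitVector (Φ.Es 0 x) 0 = w.repr x 0 • w 0 := by
        simp [splitVector, tau, hux]
      rw [h0]
      refine ⟨fun j hj => ?_, ?_⟩
      · have : (0 : Fin (d + 1)) ≠ j := by
          rintro rfl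
          simp at hj
        simp [this]
      · simpa using hc
    | succ n ih =>
      intro hn
      obtain ⟨ih1, ih2⟩ := ih (by omega)
      have hs : Φ.splitVector (Φ.Es 0 x) (n + 1) = Φ.A (Φ.splitVector (Φ.Es 0 x) n)
          - Φ.th ⟨n, by omega⟩ • Φ.splitVector (Φ.Es 0 x) n := by
        have := Φ.tau_succ ⟨n, by omega⟩
        simp only at this
        rw [splitVector, this]
        simp [splitVector, sub_mul, Algebra.algebraMap_eq_smul_one]
      rw [hs]
      refine ⟨fun j hj => ?_, ?_⟩
      · rw [map_sub, Finsupp.sub_apply, hreprA, map_smul, Finsupp.smul_apply,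
          ih1 j (by omega), smul_zero, sub_zero]
        refine Finset.sum_eq_zero fun k _ => ?_
        by_cases hk : n < (k : ℕ)
        · rw [ih1 k hk, mul_zero]
        · rw [htri.1 j k (Or.inr (by omega)), zero_mul]
      · rw [map_sub, Finsupp.sub_apply, hreprA, map_smul, Finsupp.smul_apply,
          ih1 ⟨n + 1, hn⟩ (by simp), smul_zero, sub_zero,
          Finset.sum_eq_single ⟨n, by omega⟩]
        · exact mul_ne_zero (htri.2 _ _ (Or.inr rfl)) ih2
        · intro k _ hk
          have hk' : (k : ℕ) ≠ n := fun h => hk (Fin.ext h)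
          by_cases hk2 : n < (k : ℕ)
          · rw [ih1 k hk2, mul_zero]
          · rw [htri.1 ⟨n + 1, hn⟩ k (Or.inr (by simp only; omega)), zero_mul]
        · simp
  rw [w.is_basis_iff_det, Module.Basis.det_apply, Matrix.det_of_isUpperTriangular]
  · rw [isUnit_iff_ne_zero, Finset.prod_ne_zero_iff]
    intro i _
    exact (hind i i.2).2
  · intro i j hij
    exact (hind j j.2).1 i hij

theorem exists_mem_range_Es_zero (Φ : LeonardSystem F V d) :
    ∃ u : V, u ∈ LinearMap.range (Φ.Es 0) ∧ u ≠ 0 := by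
  obtain ⟨⟨-, -, w, hw, -⟩, hE⟩ := Φ.ths_spec
  exact ⟨w 0, ⟨w 0, (hE 0).1 _ (Module.End.mem_eigenspace_iff.2 (hw 0))⟩, w.ne_zero 0⟩

/-- The `Φ`-split basis `u_i = τ_i(A) u` obtained from a nonzero vector `u` in `E^*_0 V`. -/
noncomputable def splitBasis (Φ : LeonardSystem F V d) (u : V)
    (hu : u ∈ LinearMap.range (Φ.Es 0) ∧ u ≠ 0) : Module.Basis (Fin (d + 1)) F V :=
  Module.Basis.mk (Φ.splitVector_isBasis hu.1 hu.2).1 (Φ.splitVector_isBasis hu.1 hu.2).2.ge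

/-- The first split sequence `φ_1, …, φ_d`: the entry `φ_i` in row `i - 1` and column `i`
(counted from `0`) of the matrix that represents `A^*` with respect to a `Φ`-split basis.
It does not depend on the choice of that basis, since `E^*_0 V` has dimension one.
Indices outside `1, …, d` are not used. -/
noncomputable def varphi (Φ : LeonardSystem F V d) (i : ℕ) : F :=
  if h : 1 ≤ i ∧ i ≤ d then
    let b := Φ.splitBasis Φ.exists_mem_range_Es_zero.choose Φ.exists_mem_range_Es_zero.choose_spec
    LinearMap.toMatrix b b Φ.As ⟨i - 1, by omega⟩ ⟨i, by omega⟩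
  else 0

/-- The second split sequence: the first split sequence of `(A; {E_{d-i}}; A^*; {E^*_i})`. -/
noncomputable def phi (Φ : LeonardSystem F V d) (i : ℕ) : F :=
  Φ.flip.varphi i

/-- The scalar `a_i = tr(E^*_i A)`. -/
noncomputable def a (Φ : LeonardSystem F V d) (i : Fin (d + 1)) : F :=
  LinearMap.trace F V (Φ.Es i * Φ.A)

/-- `X` has zero diagonal: `E^*_i X E^*_i = 0` for all `i`. -/
def HasZeroDiagonal (Φ : LeonardSystem F V d) (X : Module.End F V) : Prop :=
  ∀ i, Φ.Es i * X * Φ.Es i = 0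

/-- The zero diagonal space `Z(Φ)`: the elements of `Span {I, A^*, A, A A^*}` that have zero
diagonal. -/
def Z (Φ : LeonardSystem F V d) : Submodule F (Module.End F V) where
  carrier := {X | X ∈ Submodule.span F {1, Φ.As, Φ.A, Φ.A * Φ.As} ∧ Φ.HasZeroDiagonal X}
  zero_mem' := ⟨Submodule.zero_mem _, fun i => by simp⟩
  add_mem' := fun hX hY => ⟨Submodule.add_mem _ hX.1 hY.1, fun i => by
    rw [mul_add, add_mul, hX.2 i, hY.2 i, add_zero]⟩
  smul_mem' := fun c X hX => ⟨Submodule.smul_mem _ c hX.1, fun i => by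
    rw [mul_smul_comm, smul_mul_assoc, hX.2 i, smul_zero]⟩

/-- The combination `α (A - a_0 I)(A^* - θ^*_d I) - β (A - a_d I)(A^* - θ^*_0 I)`. -/
noncomputable def combination (Φ : LeonardSystem F V d) (α β : F) : Module.End F V :=
  α • ((Φ.A - Φ.a 0 • 1) * (Φ.As - Φ.ths (Fin.last d) • 1)) -
    β • ((Φ.A - Φ.a (Fin.last d) • 1) * (Φ.As - Φ.ths 0 • 1))

/-- `X` is a nonzero element of `Z(Φ)` and, if `Z(Φ)` has dimension one, a basis of `Z(Φ)`. -/
def IsNonzeroAndBasisIfDimOne (Φ : LeonardSystem F V d) (X : Module.End F V) : Prop :=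
  X ≠ 0 ∧ X ∈ Φ.Z ∧
    (Module.finrank F Φ.Z = 1 →
      ∃ b : Module.Basis (Fin 1) F Φ.Z, ((b 0 : Φ.Z) : Module.End F V) = X)

/-! In the following definitions of the types, the scalars that occur in a type are arguments:
`Φ` has the type if the property holds for some choice of them. -/

/-- `Φ` has `q`-Racah type with the given scalars. -/
def IsQRacah (Φ : LeonardSystem F V d) (q h hs s ss r₁ r₂ : F) : Prop :=
  (q ≠ 0 ∧ h ≠ 0 ∧ hs ≠ 0 ∧ s ≠ 0 ∧ ss ≠ 0 ∧ r₁ ≠ 0 ∧ r₂ ≠ 0) ∧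
  r₁ * r₂ = s * ss * q ^ (d + 1) ∧
  (∀ i : ℕ, 1 ≤ i → i ≤ d → q ^ i ≠ 1 ∧ r₁ * q ^ i ≠ 1 ∧ r₂ * q ^ i ≠ 1 ∧
    ss * q ^ i / r₁ ≠ 1 ∧ ss * q ^ i / r₂ ≠ 1) ∧
  (∀ i : ℕ, 2 ≤ i → i ≤ 2 * d → s * q ^ i ≠ 1 ∧ ss * q ^ i ≠ 1) ∧
  (∀ i : Fin (d + 1),
    Φ.th i = Φ.th 0 +
      h * (1 - q ^ (i : ℕ)) * (1 - s * q ^ ((i : ℕ) + 1)) * q ^ (-((i : ℕ) : ℤ)) ∧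
    Φ.ths i = Φ.ths 0 +
      hs * (1 - q ^ (i : ℕ)) * (1 - ss * q ^ ((i : ℕ) + 1)) * q ^ (-((i : ℕ) : ℤ))) ∧
  (∀ i : ℕ, 1 ≤ i → i ≤ d →
    Φ.varphi i = h * hs * q ^ (1 - 2 * (i : ℤ)) * (1 - q ^ i) * (1 - q ^ ((i : ℤ) - d - 1)) *
      (1 - r₁ * q ^ i) * (1 - r₂ * q ^ i) ∧
    Φ.phi i = h * hs * q ^ (1 - 2 * (i : ℤ)) * (1 - q ^ i) * (1 - q ^ ((i : ℤ) - d - 1)) *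
      (r₁ - ss * q ^ i) * (r₂ - ss * q ^ i) / ss)

/-- `Φ` has `q`-Hahn type with the given scalars. -/
def IsQHahn (Φ : LeonardSystem F V d) (q h hs ss r : F) : Prop :=
  (q ≠ 0 ∧ h ≠ 0 ∧ hs ≠ 0 ∧ ss ≠ 0 ∧ r ≠ 0) ∧
  (∀ i : ℕ, 1 ≤ i → i ≤ d → q ^ i ≠ 1 ∧ r * q ^ i ≠ 1 ∧ ss * q ^ i / r ≠ 1) ∧
  (∀ i : ℕ, 2 ≤ i → i ≤ 2 * d → ss * q ^ i ≠ 1) ∧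
  (∀ i : Fin (d + 1),
    Φ.th i = Φ.th 0 + h * (1 - q ^ (i : ℕ)) * q ^ (-((i : ℕ) : ℤ)) ∧
    Φ.ths i = Φ.ths 0 +
      hs * (1 - q ^ (i : ℕ)) * (1 - ss * q ^ ((i : ℕ) + 1)) * q ^ (-((i : ℕ) : ℤ))) ∧
  (∀ i : ℕ, 1 ≤ i → i ≤ d →
    Φ.varphi i = h * hs * q ^ (1 - 2 * (i : ℤ)) * (1 - q ^ i) * (1 - q ^ ((i : ℤ) - d - 1)) *
      (1 - r * q ^ i) ∧
    Φ.phi i = -(h * hs * q ^ (1 - (i : ℤ)) * (1 - q ^ i) * (1 - q ^ ((i : ℤ) - d - 1)) *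
      (r - ss * q ^ i)))

/-- `Φ` has dual `q`-Krawtchouk type with the given scalars. -/
def IsDualQKrawtchouk (Φ : LeonardSystem F V d) (q h hs s : F) : Prop :=
  (q ≠ 0 ∧ h ≠ 0 ∧ hs ≠ 0 ∧ s ≠ 0) ∧
  (∀ i : ℕ, 1 ≤ i → i ≤ d → q ^ i ≠ 1) ∧
  (∀ i : ℕ, 2 ≤ i → i ≤ 2 * d → s * q ^ i ≠ 1) ∧
  (∀ i : Fin (d + 1),
    Φ.th i = Φ.th 0 +
      h * (1 - q ^ (i : ℕ)) * (1 - s * q ^ ((i : ℕ) + 1)) * q ^ (-((i : ℕ) : ℤ)) ∧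
    Φ.ths i = Φ.ths 0 + hs * (1 - q ^ (i : ℕ)) * q ^ (-((i : ℕ) : ℤ))) ∧
  (∀ i : ℕ, 1 ≤ i → i ≤ d →
    Φ.varphi i = h * hs * q ^ (1 - 2 * (i : ℤ)) * (1 - q ^ i) * (1 - q ^ ((i : ℤ) - d - 1)) ∧
    Φ.phi i = h * hs * s * q ^ ((d : ℤ) + 2 - 2 * i) * (1 - q ^ i) *
      (1 - q ^ ((i : ℤ) - d - 1)))

/-- `Φ` has Racah type with the given scalars. -/
def IsRacah (Φ : LeonardSystem F V d) (h hs s ss r₁ r₂ : F) : Prop :=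
  (h ≠ 0 ∧ hs ≠ 0) ∧
  r₁ + r₂ = s + ss + d + 1 ∧
  (ringChar F = 0 ∨ d < ringChar F) ∧
  (∀ i : ℕ, 1 ≤ i → i ≤ d → r₁ ≠ -i ∧ r₂ ≠ -i ∧ ss - r₁ ≠ -i ∧ ss - r₂ ≠ -i) ∧
  (∀ i : ℕ, 2 ≤ i → i ≤ 2 * d → s ≠ -i ∧ ss ≠ -i) ∧
  (∀ i : Fin (d + 1),
    Φ.th i = Φ.th 0 + h * (i : ℕ) * ((i : ℕ) + 1 + s) ∧
    Φ.ths i = Φ.ths 0 + hs * (i : ℕ) * ((i : ℕ) + 1 + ss)) ∧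
  (∀ i : ℕ, 1 ≤ i → i ≤ d →
    Φ.varphi i = h * hs * i * (i - d - 1) * (i + r₁) * (i + r₂) ∧
    Φ.phi i = h * hs * i * (i - d - 1) * (i + ss - r₁) * (i + ss - r₂))

/-- `Φ` has Hahn type with the given scalars. -/
def IsHahn (Φ : LeonardSystem F V d) (hs s ss r : F) : Prop :=
  (hs ≠ 0 ∧ s ≠ 0) ∧
  (ringChar F = 0 ∨ d < ringChar F) ∧
  (∀ i : ℕ, 1 ≤ i → i ≤ d → r ≠ -i ∧ ss - r ≠ -i) ∧
  (∀ i : ℕ, 2 ≤ i → i ≤ 2 * d → ss ≠ -i) ∧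
  (∀ i : Fin (d + 1),
    Φ.th i = Φ.th 0 + s * (i : ℕ) ∧
    Φ.ths i = Φ.ths 0 + hs * (i : ℕ) * ((i : ℕ) + 1 + ss)) ∧
  (∀ i : ℕ, 1 ≤ i → i ≤ d →
    Φ.varphi i = hs * s * i * (i - d - 1) * (i + r) ∧
    Φ.phi i = -(hs * s * i * (i - d - 1) * (i + ss - r)))

/-- `Φ` has Krawtchouk type with the given scalars. -/
def IsKrawtchouk (Φ : LeonardSystem F V d) (s ss r : F) : Prop :=
  (s ≠ 0 ∧ ss ≠ 0 ∧ r ≠ 0) ∧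
  (ringChar F = 0 ∨ d < ringChar F) ∧
  r ≠ s * ss ∧
  (∀ i : Fin (d + 1),
    Φ.th i = Φ.th 0 + s * (i : ℕ) ∧
    Φ.ths i = Φ.ths 0 + ss * (i : ℕ)) ∧
  (∀ i : ℕ, 1 ≤ i → i ≤ d →
    Φ.varphi i = r * i * (i - d - 1) ∧
    Φ.phi i = (r - s * ss) * i * (i - d - 1))

/-- `Φ` has Bannai/Ito type with the given scalars. -/
def IsBannaiIto (Φ : LeonardSystem F V d) (h hs s ss r₁ r₂ : F) : Prop :=
  (h ≠ 0 ∧ hs ≠ 0) ∧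
  (ringChar F = 0 ∨ (Odd (ringChar F) ∧ d < 2 * ringChar F)) ∧
  r₁ + r₂ = -s - ss + d + 1 ∧
  (∀ i : ℕ, 1 ≤ i → i ≤ d → Even (d - i) → r₁ ≠ -i ∧ -ss - r₁ ≠ -i) ∧
  (∀ i : ℕ, 1 ≤ i → i ≤ d → Odd i → r₂ ≠ -i ∧ -ss - r₂ ≠ -i) ∧
  (∀ i : ℕ, 1 ≤ i → i ≤ d → s ≠ 2 * i ∧ ss ≠ 2 * i) ∧
  (∀ i : Fin (d + 1),
    Φ.th i = Φ.th 0 + h * (s - 1 + (1 - s + 2 * (i : ℕ)) * (-1) ^ (i : ℕ)) ∧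
    Φ.ths i = Φ.ths 0 + hs * (ss - 1 + (1 - ss + 2 * (i : ℕ)) * (-1) ^ (i : ℕ))) ∧
  (∀ i : ℕ, 1 ≤ i → i ≤ d →
    (Even i → Even d →
      Φ.varphi i = -4 * h * hs * i * (i + r₁) ∧
      Φ.phi i = 4 * h * hs * i * (i - ss - r₁)) ∧
    (Odd i → Even d →
      Φ.varphi i = -4 * h * hs * (i - d - 1) * (i + r₂) ∧
      Φ.phi i = 4 * h * hs * (i - d - 1) * (i - ss - r₂)) ∧
    (Even i → Odd d →
      Φ.varphi i = -4 * h * hs * i * (i - d - 1) ∧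
      Φ.phi i = -4 * h * hs * i * (i - d - 1)) ∧
    (Odd i → Odd d →
      Φ.varphi i = -4 * h * hs * (i + r₁) * (i + r₂) ∧
      Φ.phi i = -4 * h * hs * (i - ss - r₁) * (i - ss - r₂)))

end Basic

end LeonardSystem

/-! In an eigenbasis of `A^*` the map `A^*` is diagonal, `A` is irreducible tridiagonal with
diagonal entries `a_i`, and `E^*_i X E^*_i = 0` says that the entry `(i,i)` of `X` is zero. The
diagonal entries of `αP - βQ` at `0` and `d` vanish by construction, so membership in `Z` amounts to
`α (a_i - a_0)(θ*_i - θ*_d) = β (a_i - a_d)(θ*_i - θ*_0)` for `0 < i < d`. The off-diagonal entries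
in columns `0` and `d` show that `αP - βQ ≠ 0` as soon as `(α, β) ≠ (0, 0)`.

The `a_i` are computed from the split basis, which is triangular with respect to the eigenbasis.
With `c_i = φ_i / (θ*_i - θ*_{i-1})`, where `φ_i` is the first split sequence, the result is `a_i =
θ_i + c_i - c_{i+1}`, with `c_0` and `c_{d+1}` read as `0` (`a_zero`, `a_succ`, `a_last`). What
remains is a scalar identity for each type (`combination_isNonzeroAndBasis_of_eq`).

A common mechanism lies behind these identities. The condition on `s*`, where there is one, makes a
factor of `φ_i` cancel against `θ*_i - θ*_{i-1}`. In the Racah and Krawtchouk cases `a_i` is then an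
affine function of `θ*_i`, whence `α = β = 1`. In the other cases `a_i = const + K / N_i` for `0 < i
< d`, where `N_i` is affine in `θ*_i`, and `α : β = N_0 : N_d`. Both cannot vanish, because `N_d -
N_0` is a nonzero multiple of `θ*_d - θ*_0`. -/

namespace LeonardSystem

variable {F V : Type*} [Field F] [AddCommGroup V] [Module F V] {d : ℕ}

/-! ### Matrices with respect to an eigenbasis of `A^*` -/

/-- A basis of eigenvectors of `A^*`, in the order of the dual eigenvalue sequence. -/
noncomputable def dualEigenbasis (Φ : LeonardSystem F V d) : Module.Basis (Fin (d + 1)) F V :=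
  Φ.ths_spec.1.2.2.choose

/-- The matrix of `A` with respect to a basis of eigenvectors of `A^*`. -/
noncomputable def dualMatrix (Φ : LeonardSystem F V d) : Matrix (Fin (d + 1)) (Fin (d + 1)) F :=
  LinearMap.toMatrix Φ.dualEigenbasis Φ.dualEigenbasis Φ.A

theorem ths_injective (Φ : LeonardSystem F V d) : Function.Injective Φ.ths := Φ.ths_spec.1.1

theorem As_dualEigenbasis (Φ : LeonardSystem F V d) (i : Fin (d + 1)) :
    Φ.As (Φ.dualEigenbasis i) = Φ.ths i • Φ.dualEigenbasis i :=
  Φ.ths_spec.1.2.2.choose_spec.1 i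

theorem dualMatrix_tridiagonal (Φ : LeonardSystem F V d) :
    IsIrreducibleTridiagonal Φ.dualMatrix :=
  Φ.ths_spec.1.2.2.choose_spec.2

theorem Es_dualEigenbasis (Φ : LeonardSystem F V d) (i j : Fin (d + 1)) :
    Φ.Es i (Φ.dualEigenbasis j) = if j = i then Φ.dualEigenbasis j else 0 := by
  have hj := Module.End.mem_eigenspace_iff.2 (Φ.As_dualEigenbasis j)
  split_ifs with h
  · subst h
    exact (Φ.ths_spec.2 j).1 _ hj
  · exact (Φ.ths_spec.2 i).2 _ (fun h' => h (Φ.ths_injective h')) _ hj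

theorem repr_Es (Φ : LeonardSystem F V d) (i j : Fin (d + 1)) (x : V) :
    Φ.dualEigenbasis.repr (Φ.Es i x) j = if j = i then Φ.dualEigenbasis.repr x j else 0 := by
  conv_lhs => rw [← Φ.dualEigenbasis.sum_repr x]
  simp only [map_sum, map_smul, Es_dualEigenbasis, smul_ite, smul_zero, Finset.sum_ite_eq',
    Finset.mem_univ, if_true, Module.Basis.repr_self, Finsupp.smul_apply, Finsupp.single_apply,
    smul_eq_mul]
  by_cases h : j = i
  · simp [h]
  · simp [h, Ne.symm h]

theorem repr_As (Φ : LeonardSystem F V d) (j : Fin (d + 1)) (x : V) :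
    Φ.dualEigenbasis.repr (Φ.As x) j = Φ.ths j * Φ.dualEigenbasis.repr x j := by
  conv_lhs => rw [← Φ.dualEigenbasis.sum_repr x]
  simp only [map_sum, map_smul, As_dualEigenbasis, Module.Basis.repr_self, Finsupp.coe_finsetSum,
    Finset.sum_apply, Finsupp.smul_apply, Finsupp.single_apply, smul_eq_mul]
  rw [Finset.sum_eq_single j]
  · simp [mul_comm]
  · intro b _ hb
    simp [hb]
  · simp

theorem repr_A (Φ : LeonardSystem F V d) (j : Fin (d + 1)) (x : V) :
    Φ.dualEigenbasis.repr (Φ.A x) j = ∑ k, Φ.dualMatrix j k * Φ.dualEigenbasis.repr x k := by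
  have := congrFun (LinearMap.toMatrix_mulVec_repr Φ.dualEigenbasis Φ.dualEigenbasis Φ.A x) j
  rw [← this]
  rfl

theorem a_eq_dualMatrix (Φ : LeonardSystem F V d) (i : Fin (d + 1)) :
    Φ.a i = Φ.dualMatrix i i := by
  rw [a, LinearMap.trace_eq_matrix_trace F Φ.dualEigenbasis, Matrix.trace,
    Finset.sum_eq_single i]
  · simp [LinearMap.toMatrix_apply, repr_Es, dualMatrix]
  · intro j _ hj
    simp [LinearMap.toMatrix_apply, repr_Es, hj]
  · simp

theorem hasZeroDiagonal_of_toMatrix (Φ : LeonardSystem F V d) {X : Module.End F V}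
    (h : ∀ i, LinearMap.toMatrix Φ.dualEigenbasis Φ.dualEigenbasis X i i = 0) :
    Φ.HasZeroDiagonal X := by
  intro i
  refine Φ.dualEigenbasis.ext fun j => Φ.dualEigenbasis.ext_elem fun k => ?_
  rw [Module.End.mul_apply, Module.End.mul_apply, repr_Es, Es_dualEigenbasis]
  by_cases hj : j = i
  · by_cases hk : k = i
    · have := h i
      rw [LinearMap.toMatrix_apply] at this
      simpa [hj, hk] using this
    · simp [hk]
  · simp [hj]

theorem toMatrix_sub_mul_sub (Φ : LeonardSystem F V d) (x y : F) (i j : Fin (d + 1)) :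
    LinearMap.toMatrix Φ.dualEigenbasis Φ.dualEigenbasis ((Φ.A - x • 1) * (Φ.As - y • 1)) i j
      = (Φ.dualMatrix i j - x * (1 : Matrix (Fin (d + 1)) (Fin (d + 1)) F) i j) *
        (Φ.ths j - y) := by
  have : (Φ.As - y • 1) (Φ.dualEigenbasis j) = (Φ.ths j - y) • Φ.dualEigenbasis j := by
    simp [As_dualEigenbasis, sub_smul]
  rw [LinearMap.toMatrix_apply, Module.End.mul_apply, this, map_smul, map_smul,
    Finsupp.smul_apply, dualMatrix, LinearMap.toMatrix_apply, smul_eq_mul, mul_comm]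
  simp [Matrix.one_apply, Finsupp.single_apply, eq_comm]

theorem toMatrix_combination (Φ : LeonardSystem F V d) (α β : F) (i j : Fin (d + 1)) :
    LinearMap.toMatrix Φ.dualEigenbasis Φ.dualEigenbasis (Φ.combination α β) i j
      = α * ((Φ.dualMatrix i j - Φ.a 0 * (1 : Matrix (Fin (d + 1)) (Fin (d + 1)) F) i j) *
          (Φ.ths j - Φ.ths (Fin.last d))) -
        β * ((Φ.dualMatrix i j -
          Φ.a (Fin.last d) * (1 : Matrix (Fin (d + 1)) (Fin (d + 1)) F) i j) *
          (Φ.ths j - Φ.ths 0)) := by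
  rw [combination, map_sub, map_smul, map_smul, Matrix.sub_apply, Matrix.smul_apply,
    Matrix.smul_apply, toMatrix_sub_mul_sub, toMatrix_sub_mul_sub, smul_eq_mul, smul_eq_mul]

theorem combination_mem_span (Φ : LeonardSystem F V d) (α β : F) :
    Φ.combination α β ∈ Submodule.span F {1, Φ.As, Φ.A, Φ.A * Φ.As} := by
  have key : ∀ x y : F, (Φ.A - x • 1) * (Φ.As - y • 1)
      ∈ Submodule.span F {1, Φ.As, Φ.A, Φ.A * Φ.As} := by
    intro x y
    have : (Φ.A - x • 1) * (Φ.As - y • 1)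
        = Φ.A * Φ.As - y • Φ.A - x • Φ.As + (y * x) • (1 : Module.End F V) := by
      simp only [sub_mul, mul_sub, smul_mul_assoc, mul_smul_comm, one_mul, mul_one, smul_sub,
        smul_smul]
      abel
    rw [this]
    refine Submodule.add_mem _ (Submodule.sub_mem _ (Submodule.sub_mem _ ?_ ?_) ?_) ?_
    · exact Submodule.subset_span (by simp)
    all_goals exact Submodule.smul_mem _ _ (Submodule.subset_span (by simp))
  exact Submodule.sub_mem _ (Submodule.smul_mem _ _ (key _ _)) (Submodule.smul_mem _ _ (key _ _))

/-- Off the diagonal the scalars `a_0`, `a_d` drop out, and irreducibility allows the entry of `A`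
to be cancelled. -/
theorem combination_ne_zero (Φ : LeonardSystem F V d) (hd : 2 ≤ d) {α β : F}
    (h : α ≠ 0 ∨ β ≠ 0) : Φ.combination α β ≠ 0 := by
  intro h0
  have hoff : ∀ i j : Fin (d + 1), (i : ℕ) + 1 = j ∨ (j : ℕ) + 1 = i →
      α * (Φ.ths j - Φ.ths (Fin.last d)) = β * (Φ.ths j - Φ.ths 0) := by
    intro i j hij
    have := Φ.toMatrix_combination α β i j
    have hne : i ≠ j := by rintro rfl; omega
    rw [h0] at this
    simp only [map_zero, Matrix.zero_apply, Matrix.one_apply_ne hne, mul_zero, sub_zero] at this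
    refine mul_left_cancel₀ (Φ.dualMatrix_tridiagonal.2 i j hij) ?_
    linear_combination -this
  have hne : Φ.ths 0 - Φ.ths (Fin.last d) ≠ 0 := fun h => by
    have := Φ.ths_injective (sub_eq_zero.1 h)
    rw [Fin.ext_iff] at this
    simp at this
    omega
  -- In column `0` the factor of `β` vanishes, in column `d` that of `α`; the other factor is
  -- `±(θ*_0 - θ*_d)`.
  have h1 := hoff ⟨1, by omega⟩ 0 (Or.inr rfl)
  have h2 := hoff ⟨d - 1, by omega⟩ (Fin.last d) (Or.inl (by simp; omega))
  rw [sub_self, mul_zero] at h1 h2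
  have hα : α = 0 := (mul_eq_zero.1 h1).resolve_right hne
  have hβ : β = 0 := (mul_eq_zero.1 h2.symm).resolve_right
    (fun h => hne (by linear_combination -h))
  tauto

theorem isNonzeroAndBasisIfDimOne_of_mem [FiniteDimensional F V] (Φ : LeonardSystem F V d)
    {X : Module.End F V} (h0 : X ≠ 0) (hX : X ∈ Φ.Z) : Φ.IsNonzeroAndBasisIfDimOne X := by
  refine ⟨h0, hX, fun h1 => ?_⟩
  have hli : LinearIndependent F (fun _ : Fin 1 => (⟨X, hX⟩ : Φ.Z)) :=
    LinearIndependent.of_subsingleton 0 (fun h => h0 (congrArg Subtype.val h))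
  refine ⟨basisOfLinearIndependentOfCardEqFinrank hli (by simp [h1]), ?_⟩
  simp

/-- A sufficient condition on the scalars `a_i` and the dual eigenvalue sequence. -/
theorem combination_isNonzeroAndBasis [FiniteDimensional F V] (Φ : LeonardSystem F V d)
    (hd : 2 ≤ d) {α β : F} (h : α ≠ 0 ∨ β ≠ 0)
    (hm : ∀ i : Fin (d + 1), 0 < (i : ℕ) → (i : ℕ) < d →
      α * ((Φ.a i - Φ.a 0) * (Φ.ths i - Φ.ths (Fin.last d))) =
        β * ((Φ.a i - Φ.a (Fin.last d)) * (Φ.ths i - Φ.ths 0))) :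
    Φ.IsNonzeroAndBasisIfDimOne (Φ.combination α β) := by
  refine Φ.isNonzeroAndBasisIfDimOne_of_mem (Φ.combination_ne_zero hd h)
    ⟨Φ.combination_mem_span α β, Φ.hasZeroDiagonal_of_toMatrix fun i => ?_⟩
  rw [toMatrix_combination, Matrix.one_apply_eq, mul_one, mul_one, ← a_eq_dualMatrix]
  by_cases hi0 : i = 0
  · subst hi0
    simp
  by_cases hid : i = Fin.last d
  · subst hid
    simp
  rw [sub_eq_zero]
  refine hm i (Nat.pos_of_ne_zero fun h => hi0 (Fin.ext h)) ?_
  have : (i : ℕ) ≠ d := fun h => hid (Fin.ext h)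
  omega

/-! ### The split basis and the formula for `a_i` -/

/-- The vector in `E^*_0 V` from which the split sequence is computed. -/
noncomputable def splitSeed (Φ : LeonardSystem F V d) : V := Φ.exists_mem_range_Es_zero.choose

theorem splitSeed_spec (Φ : LeonardSystem F V d) :
    Φ.splitSeed ∈ LinearMap.range (Φ.Es 0) ∧ Φ.splitSeed ≠ 0 :=
  Φ.exists_mem_range_Es_zero.choose_spec

theorem splitVector_splitSeed_zero (Φ : LeonardSystem F V d) :
    Φ.splitVector Φ.splitSeed 0 = Φ.splitSeed := by
  simp [splitVector, tau]

/-- The coordinates of the split basis with respect to the eigenvectors of `A^*`. -/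
noncomputable def splitCoord (Φ : LeonardSystem F V d) (n : ℕ) (j : Fin (d + 1)) : F :=
  Φ.dualEigenbasis.repr (Φ.splitVector Φ.splitSeed n) j

theorem splitVector_succ (Φ : LeonardSystem F V d) (i : Fin (d + 1)) (u : V) :
    Φ.splitVector u ((i : ℕ) + 1) = Φ.A (Φ.splitVector u i) - Φ.th i • Φ.splitVector u i := by
  rw [splitVector, Φ.tau_succ i]
  simp [splitVector, sub_mul, Algebra.algebraMap_eq_smul_one]

/-- `τ_{d+1}` has every eigenvalue of `A` as a root, so it annihilates an eigenbasis of `A`. -/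
theorem splitVector_last_succ (Φ : LeonardSystem F V d) (u : V) :
    Φ.splitVector u (d + 1) = 0 := by
  obtain ⟨⟨-, -, v, hv, -⟩, -⟩ := Φ.th_spec
  have : Polynomial.aeval Φ.A (Φ.tau (d + 1)) = 0 := by
    refine v.ext fun i => ?_
    rw [Module.End.aeval_apply_of_hasEigenvector
      (⟨Module.End.mem_eigenspace_iff.2 (hv i), v.ne_zero i⟩ :
        Module.End.HasEigenvector Φ.A (Φ.th i) (v i)), tau, Polynomial.eval_prod,
      Finset.prod_eq_zero (i := i)]
    · simp
    · simpa using Nat.lt_succ_iff.1 i.2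
    · simp
  rw [splitVector, this, LinearMap.zero_apply]

theorem splitCoord_succ (Φ : LeonardSystem F V d) (i j : Fin (d + 1)) :
    Φ.splitCoord ((i : ℕ) + 1) j
      = ∑ k, Φ.dualMatrix j k * Φ.splitCoord i k - Φ.th i * Φ.splitCoord i j := by
  rw [splitCoord, splitVector_succ, map_sub, Finsupp.sub_apply, repr_A, map_smul,
    Finsupp.smul_apply, smul_eq_mul]
  rfl

theorem splitCoord_zero (Φ : LeonardSystem F V d) (j : Fin (d + 1)) (hj : j ≠ 0) :
    Φ.splitCoord 0 j = 0 := by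
  obtain ⟨⟨x, hx⟩, -⟩ := Φ.splitSeed_spec
  rw [splitCoord, splitVector_splitSeed_zero, ← hx, repr_Es, if_neg hj]

theorem splitCoord_zero_zero_ne (Φ : LeonardSystem F V d) : Φ.splitCoord 0 0 ≠ 0 := by
  intro h
  refine Φ.splitSeed_spec.2 ?_
  rw [← splitVector_splitSeed_zero]
  refine Φ.dualEigenbasis.ext_elem fun j => ?_
  by_cases hj : j = 0
  · subst hj
    simpa [splitCoord] using h
  · simpa [splitCoord] using Φ.splitCoord_zero j hj

/-- A tridiagonal matrix moves the support of a vector up by at most one index, and `u_0` is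
supported at index `0`. -/
theorem splitCoord_of_lt (Φ : LeonardSystem F V d) (n : ℕ) (hn : n < d + 1) (j : Fin (d + 1))
    (hj : n < j) : Φ.splitCoord n j = 0 := by
  induction n generalizing j with
  | zero => exact Φ.splitCoord_zero j (fun h => by simp [h] at hj)
  | succ n ih =>
    rw [Φ.splitCoord_succ ⟨n, by omega⟩ j, ih (by omega) j (by omega), mul_zero, sub_zero]
    refine Finset.sum_eq_zero fun k _ => ?_
    by_cases hk : n < (k : ℕ)
    · rw [ih (by omega) k hk, mul_zero]
    · rw [Φ.dualMatrix_tridiagonal.1 j k (Or.inr (by omega)), zero_mul]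

theorem splitCoord_succ_self (Φ : LeonardSystem F V d) (n : ℕ) (hn : n + 1 < d + 1) :
    Φ.splitCoord (n + 1) ⟨n + 1, hn⟩
      = Φ.dualMatrix ⟨n + 1, hn⟩ ⟨n, by omega⟩ * Φ.splitCoord n ⟨n, by omega⟩ := by
  rw [Φ.splitCoord_succ ⟨n, by omega⟩, Φ.splitCoord_of_lt n (by omega) ⟨n + 1, hn⟩ (by simp),
    mul_zero, sub_zero, Finset.sum_eq_single ⟨n, by omega⟩]
  · intro k _ hk
    have hk' : (k : ℕ) ≠ n := fun h => hk (Fin.ext h)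
    by_cases hk2 : n < (k : ℕ)
    · rw [Φ.splitCoord_of_lt n (by omega) k hk2, mul_zero]
    · rw [Φ.dualMatrix_tridiagonal.1 ⟨n + 1, hn⟩ k (Or.inr (by simp only; omega)), zero_mul]
  · simp

theorem splitCoord_self_ne (Φ : LeonardSystem F V d) (n : ℕ) (hn : n < d + 1) :
    Φ.splitCoord n ⟨n, hn⟩ ≠ 0 := by
  induction n with
  | zero => exact Φ.splitCoord_zero_zero_ne
  | succ n ih =>
    rw [splitCoord_succ_self]
    exact mul_ne_zero (Φ.dualMatrix_tridiagonal.2 _ _ (Or.inr rfl)) (ih (by omega))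

/-- Coordinate `n + 1` of `u_{n+2} = A u_{n+1} - θ_{n+1} u_{n+1}`; triangularity leaves only two
terms of the sum. The diagonal entry `a_{n+1}` enters here. -/
theorem splitCoord_succ_prev (Φ : LeonardSystem F V d) (n : ℕ) (hn : n + 1 < d + 1) :
    Φ.splitCoord (n + 2) ⟨n + 1, hn⟩
      = Φ.dualMatrix ⟨n + 1, hn⟩ ⟨n, by omega⟩ * Φ.splitCoord (n + 1) ⟨n, by omega⟩ +
        Φ.dualMatrix ⟨n + 1, hn⟩ ⟨n + 1, hn⟩ * Φ.splitCoord (n + 1) ⟨n + 1, hn⟩ -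
        Φ.th ⟨n + 1, hn⟩ * Φ.splitCoord (n + 1) ⟨n + 1, hn⟩ := by
  rw [Φ.splitCoord_succ ⟨n + 1, hn⟩, Finset.sum_eq_add ⟨n, by omega⟩ ⟨n + 1, hn⟩]
  · simp
  · intro k _ hk
    have hk' : (k : ℕ) ≠ n := fun h => hk.1 (Fin.ext h)
    have hk'' : (k : ℕ) ≠ n + 1 := fun h => hk.2 (Fin.ext h)
    by_cases hk2 : n + 1 < (k : ℕ)
    · rw [Φ.splitCoord_of_lt (n + 1) (by omega) k hk2, mul_zero]
    · rw [Φ.dualMatrix_tridiagonal.1 ⟨n + 1, hn⟩ k (Or.inr (by simp only; omega)), zero_mul]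
  · simp
  · simp

theorem splitCoord_one_zero (Φ : LeonardSystem F V d) :
    Φ.splitCoord 1 0
      = Φ.dualMatrix 0 0 * Φ.splitCoord 0 0 - Φ.th 0 * Φ.splitCoord 0 0 := by
  have := Φ.splitCoord_succ 0 0
  rw [Finset.sum_eq_single 0] at this
  · simpa using this
  · intro k _ hk
    simp [Φ.splitCoord_zero k hk]
  · simp

theorem splitCoord_last_succ (Φ : LeonardSystem F V d) (j : Fin (d + 1)) :
    Φ.splitCoord (d + 1) j = 0 := by
  simp [splitCoord, splitVector_last_succ]

theorem splitBasis_apply (Φ : LeonardSystem F V d) (u : V)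
    (hu : u ∈ LinearMap.range (Φ.Es 0) ∧ u ≠ 0) (i : Fin (d + 1)) :
    Φ.splitBasis u hu i = Φ.splitVector u i := by
  simp [splitBasis]

/-- The split basis and the eigenvectors of `A^*` induce the same flag. -/
theorem splitBasis_repr_eq_zero (Φ : LeonardSystem F V d) (n : ℕ) (x : V)
    (hx : ∀ j : Fin (d + 1), n ≤ j → Φ.dualEigenbasis.repr x j = 0) (j : Fin (d + 1))
    (hj : n ≤ j) :
    (Φ.splitBasis Φ.splitSeed Φ.splitSeed_spec).repr x j = 0 := by
  induction n generalizing x j with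
  | zero =>
    have : x = 0 := Φ.dualEigenbasis.ext_elem fun j => by simpa using hx j (Nat.zero_le _)
    simp [this]
  | succ n ih =>
    have hn : n < d + 1 := by omega
    set b := Φ.splitBasis Φ.splitSeed Φ.splitSeed_spec with hb
    set c : F := Φ.dualEigenbasis.repr x ⟨n, hn⟩ / Φ.splitCoord n ⟨n, hn⟩ with hc
    have hbn : b ⟨n, hn⟩ = Φ.splitVector Φ.splitSeed n := by
      rw [hb, splitBasis_apply]
    -- `c` is chosen to remove the top coordinate of `x`, so that the difference lies one step lower
    -- in the flag.
    have := ih (x - c • b ⟨n, hn⟩) (fun k hk => by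
      rw [map_sub, map_smul, Finsupp.sub_apply, Finsupp.smul_apply, hbn, smul_eq_mul]
      change Φ.dualEigenbasis.repr x k - c * Φ.splitCoord n k = 0
      rcases hk.eq_or_lt with h | h
      · have : k = ⟨n, hn⟩ := Fin.ext h.symm
        rw [this, hc, div_mul_cancel₀ _ (Φ.splitCoord_self_ne n hn), sub_self]
      · rw [hx k h, Φ.splitCoord_of_lt n hn k h, mul_zero, sub_zero]) j (by omega)
    have hne : (⟨n, hn⟩ : Fin (d + 1)) ≠ j := fun h => by
      rw [← h] at hj
      simp at hj
    rw [map_sub, map_smul, Module.Basis.repr_self, Finsupp.sub_apply, Finsupp.smul_apply,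
      Finsupp.single_eq_of_ne' hne, smul_zero, sub_zero] at this
    exact this

/-- Modulo the span of the lower vectors, which is the same for both bases, `x` is a multiple of
`u_n`; the factor is read off from the top coordinates. -/
theorem splitBasis_repr_mul_splitCoord (Φ : LeonardSystem F V d) (n : ℕ) (hn : n < d + 1) (x : V)
    (hx : ∀ j : Fin (d + 1), n < j → Φ.dualEigenbasis.repr x j = 0) :
    (Φ.splitBasis Φ.splitSeed Φ.splitSeed_spec).repr x ⟨n, hn⟩ *
      Φ.splitCoord n ⟨n, hn⟩ = Φ.dualEigenbasis.repr x ⟨n, hn⟩ := by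
  set b := Φ.splitBasis Φ.splitSeed Φ.splitSeed_spec with hb
  set c : F := Φ.dualEigenbasis.repr x ⟨n, hn⟩ / Φ.splitCoord n ⟨n, hn⟩ with hc
  have hbn : b ⟨n, hn⟩ = Φ.splitVector Φ.splitSeed n := by
    rw [hb, splitBasis_apply]
  have := Φ.splitBasis_repr_eq_zero n (x - c • b ⟨n, hn⟩) (fun k hk => by
    rw [map_sub, map_smul, Finsupp.sub_apply, Finsupp.smul_apply, hbn, smul_eq_mul]
    change Φ.dualEigenbasis.repr x k - c * Φ.splitCoord n k = 0
    rcases hk.eq_or_lt with h | h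
    · have : k = ⟨n, hn⟩ := Fin.ext h.symm
      rw [this, hc, div_mul_cancel₀ _ (Φ.splitCoord_self_ne n hn), sub_self]
    · rw [hx k h, Φ.splitCoord_of_lt n hn k h, mul_zero, sub_zero]) ⟨n, hn⟩ le_rfl
  rw [← hb, map_sub, map_smul, Module.Basis.repr_self, Finsupp.sub_apply, Finsupp.smul_apply,
    Finsupp.single_eq_same, smul_eq_mul, mul_one, sub_eq_zero] at this
  rw [this, hc, div_mul_cancel₀ _ (Φ.splitCoord_self_ne n hn)]

/-- `(A^* - θ*_{n+1}) u_{n+1}` has no eigenbasis coordinate above `n`, so its `u_n`-coefficient is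
fixed by its coordinate `n`. Subtracting `θ*_{n+1} u_{n+1}` does not change that coefficient, which
is therefore the split parameter. -/
theorem varphi_mul_splitCoord (Φ : LeonardSystem F V d) (n : ℕ) (hn : n + 1 < d + 1) :
    Φ.varphi (n + 1) * Φ.splitCoord n ⟨n, by omega⟩
      = (Φ.ths ⟨n, by omega⟩ - Φ.ths ⟨n + 1, hn⟩) *
        Φ.splitCoord (n + 1) ⟨n, by omega⟩ := by
  set u := Φ.splitVector Φ.splitSeed (n + 1) with hu
  have key := Φ.splitBasis_repr_mul_splitCoord n (by omega) (Φ.As u - Φ.ths ⟨n + 1, hn⟩ • u)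
    (fun j hj => by
      rw [map_sub, map_smul, Finsupp.sub_apply, Finsupp.smul_apply, repr_As, smul_eq_mul,
        ← sub_mul]
      rcases (Nat.succ_le_of_lt hj).eq_or_lt with h | h
      · have : j = ⟨n + 1, hn⟩ := Fin.ext h.symm
        rw [this, sub_self, zero_mul]
      · have := Φ.splitCoord_of_lt (n + 1) hn j h
        rw [splitCoord, ← hu] at this
        rw [this, mul_zero])
  have hbu : Φ.splitBasis Φ.splitSeed Φ.splitSeed_spec ⟨n + 1, hn⟩ = u := by
    rw [splitBasis_apply]
  have hvar : Φ.varphi (n + 1) = (Φ.splitBasis Φ.splitSeed Φ.splitSeed_spec).repr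
      (Φ.As u - Φ.ths ⟨n + 1, hn⟩ • u) ⟨n, by omega⟩ := by
    have h1 : Φ.varphi (n + 1) = (Φ.splitBasis Φ.splitSeed Φ.splitSeed_spec).repr
        (Φ.As u) ⟨n, by omega⟩ := by
      rw [varphi, dif_pos ⟨by omega, by omega⟩, ← hbu]
      exact LinearMap.toMatrix_apply _ _ _ _ _
    have h2 : (Φ.splitBasis Φ.splitSeed Φ.splitSeed_spec).repr u ⟨n, by omega⟩ = 0 := by
      rw [← hbu, Module.Basis.repr_self, Finsupp.single_eq_of_ne (by simp)]
    rw [h1, map_sub, map_smul, Finsupp.sub_apply, Finsupp.smul_apply, h2, smul_zero, sub_zero]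
  rw [hvar, key, map_sub, map_smul, Finsupp.sub_apply, Finsupp.smul_apply, repr_As, smul_eq_mul,
    ← sub_mul]
  rfl

theorem ths_sub_ne_zero (Φ : LeonardSystem F V d) {i j : Fin (d + 1)} (h : (i : ℕ) ≠ j) :
    Φ.ths i - Φ.ths j ≠ 0 :=
  sub_ne_zero.2 fun h' => h (congrArg Fin.val (Φ.ths_injective h'))

theorem splitCoord_succ_eq (Φ : LeonardSystem F V d) (n : ℕ) (hn : n + 1 < d + 1) :
    Φ.splitCoord (n + 1) ⟨n, by omega⟩
      = Φ.varphi (n + 1) / (Φ.ths ⟨n, by omega⟩ - Φ.ths ⟨n + 1, hn⟩) *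
        Φ.splitCoord n ⟨n, by omega⟩ := by
  rw [div_mul_eq_mul_div, eq_div_iff (Φ.ths_sub_ne_zero (by simp)), Φ.varphi_mul_splitCoord n hn]
  ring

theorem a_zero (Φ : LeonardSystem F V d) (hd : 0 < d) :
    Φ.a 0 = Φ.th 0 + Φ.varphi 1 / (Φ.ths 0 - Φ.ths ⟨1, by omega⟩) := by
  have h1 := Φ.splitCoord_one_zero
  have h2 := Φ.splitCoord_succ_eq 0 (by omega)
  refine mul_right_cancel₀ Φ.splitCoord_zero_zero_ne ?_
  rw [a_eq_dualMatrix]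
  simp only [zero_add, Fin.mk_zero] at h2
  linear_combination h2 - h1

/-- Eliminates the unknown subdiagonal entry of `A`: the product becomes a multiple of coordinate `n
+ 1` of `u_{n+1}`, which can be cancelled in the formula for `a_{n+1}`. -/
theorem dualMatrix_mul_splitCoord (Φ : LeonardSystem F V d) (n : ℕ) (hn : n + 1 < d + 1) :
    Φ.dualMatrix ⟨n + 1, hn⟩ ⟨n, by omega⟩ * Φ.splitCoord (n + 1) ⟨n, by omega⟩
      = -(Φ.varphi (n + 1) / (Φ.ths ⟨n + 1, hn⟩ - Φ.ths ⟨n, by omega⟩) *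
        Φ.splitCoord (n + 1) ⟨n + 1, hn⟩) := by
  rw [Φ.splitCoord_succ_eq n hn, Φ.splitCoord_succ_self n hn,
    ← neg_sub (Φ.ths ⟨n + 1, hn⟩) (Φ.ths ⟨n, by omega⟩), div_neg]
  ring

theorem a_succ (Φ : LeonardSystem F V d) (n : ℕ) (hn : n + 1 < d) :
    Φ.a ⟨n + 1, by omega⟩ = Φ.th ⟨n + 1, by omega⟩ +
      Φ.varphi (n + 1) / (Φ.ths ⟨n + 1, by omega⟩ - Φ.ths ⟨n, by omega⟩) +
      Φ.varphi (n + 2) / (Φ.ths ⟨n + 1, by omega⟩ - Φ.ths ⟨n + 2, by omega⟩) := by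
  have h1 := Φ.splitCoord_succ_prev n (by omega)
  have h2 := Φ.splitCoord_succ_eq (n + 1) (by omega)
  have h3 := Φ.dualMatrix_mul_splitCoord n (by omega)
  refine mul_right_cancel₀ (Φ.splitCoord_self_ne (n + 1) (by omega)) ?_
  rw [a_eq_dualMatrix]
  linear_combination h2 - h1 - h3

theorem a_last (Φ : LeonardSystem F V d) (hd : 0 < d) :
    Φ.a (Fin.last d) = Φ.th (Fin.last d) +
      Φ.varphi d / (Φ.ths (Fin.last d) - Φ.ths ⟨d - 1, by omega⟩) := by
  obtain ⟨n, rfl⟩ : ∃ n, d = n + 1 := ⟨d - 1, by omega⟩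
  have h1 := Φ.splitCoord_succ_prev n (by omega)
  have h3 := Φ.dualMatrix_mul_splitCoord n (by omega)
  -- Since `u_{d+1} = 0`, the term with the next split parameter is absent.
  rw [Φ.splitCoord_last_succ] at h1
  refine mul_right_cancel₀ (Φ.splitCoord_self_ne (n + 1) (by omega)) ?_
  rw [a_eq_dualMatrix]
  simp only [Fin.last, Nat.add_sub_cancel]
  linear_combination - h1 - h3

/-! ### Reduction to a scalar identity -/

/-- Outside the Krawtchouk case, and apart from powers of `q`, the denominators met below are
factors of such differences, so they are nonzero because the dual eigenvalues are distinct. -/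
theorem sub_ne_zero_of_ths_eq (Φ : LeonardSystem F V d) {g : ℕ → F}
    (hg : ∀ i : Fin (d + 1), Φ.ths i = Φ.ths 0 + g i) {i j : ℕ} (hi : i ≤ d) (hj : j ≤ d)
    (hij : i ≠ j) : g i - g j ≠ 0 := by
  have h := Φ.ths_sub_ne_zero (i := ⟨i, by omega⟩) (j := ⟨j, by omega⟩) hij
  rwa [hg ⟨i, by omega⟩, hg ⟨j, by omega⟩, add_sub_add_left_eq_sub] at h

/-- The condition for `combination α β` to lie in `Z Φ`, when the eigenvalue sequences are given
by functions `f`, `g` on the natural numbers and `c i = φ_i / (θ^*_i - θ^*_{i-1})`. -/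
theorem combination_isNonzeroAndBasis_of_eq [FiniteDimensional F V] (Φ : LeonardSystem F V d)
    (hd : 2 ≤ d) {α β : F} (h : α ≠ 0 ∨ β ≠ 0) (f g c : ℕ → F)
    (hf : ∀ i : Fin (d + 1), Φ.th i = Φ.th 0 + f i)
    (hg : ∀ i : Fin (d + 1), Φ.ths i = Φ.ths 0 + g i)
    (hc : ∀ i : ℕ, i + 1 ≤ d → Φ.varphi (i + 1) = c (i + 1) * (g (i + 1) - g i))
    (hm : ∀ n : ℕ, n + 1 < d →
      α * ((f (n + 1) + c (n + 1) - c (n + 2) + c 1) * (g (n + 1) - g d)) =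
        β * ((f (n + 1) + c (n + 1) - c (n + 2) - (f d + c d)) * g (n + 1))) :
    Φ.IsNonzeroAndBasisIfDimOne (Φ.combination α β) := by
  refine Φ.combination_isNonzeroAndBasis hd h fun i hi hid => ?_
  obtain ⟨i, hi'⟩ := i
  obtain ⟨n, rfl⟩ : ∃ n, i = n + 1 := ⟨i - 1, by have : 0 < i := hi; omega⟩
  replace hid : n + 1 < d := hid
  have hsub : ∀ i j : Fin (d + 1), Φ.ths i - Φ.ths j = g i - g j := fun i j => by
    rw [hg i, hg j, add_sub_add_left_eq_sub]
  have hg0 : g 0 = 0 := by simpa using hg 0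
  have hdiv : ∀ i : ℕ, i + 1 ≤ d → Φ.varphi (i + 1) / (g (i + 1) - g i) = c (i + 1) :=
    fun i hi => by
      rw [hc i hi, mul_div_cancel_right₀ _ (Φ.sub_ne_zero_of_ths_eq hg hi (by omega) (by omega))]
  have hdiv' : ∀ i : ℕ, i + 1 ≤ d → Φ.varphi (i + 1) / (g i - g (i + 1)) = -c (i + 1) :=
    fun i hi => by rw [← neg_sub, div_neg, hdiv i hi]
  have h1 := hdiv' 0 (by omega)
  have h2 := hdiv (d - 1) (by omega)
  rw [Nat.sub_add_cancel (by omega)] at h2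
  rw [Φ.a_succ n hid, Φ.a_zero (by omega), Φ.a_last (by omega), hf ⟨n + 1, hi'⟩,
    hf (Fin.last d)]
  simp only [hsub, Fin.val_last, Fin.val_zero, hg0, zero_sub, sub_zero] at h1 ⊢
  rw [h2, hdiv n (by omega), hdiv' (n + 1) (by omega)]
  rw [zero_add] at h1
  rw [h1]
  linear_combination hm n hid

/-! ### The `q`-types -/

/-- The scalar `φ_i / (θ^*_i - θ^*_{i-1})` for `x = q^{i-1}` and `D = q^d`, in the `q`-cases. -/
def qQuotient (q h s r D x : F) : F :=
  -(h * (1 - q * x) * (1 - x / D) * (1 - s * r * D * q ^ 2 * x) / (x * (q - 1) * (1 + r * q * x)))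

/-- For `x = q^{i-1}` the left side is `a_i - a_0`. On the right, `(1 - qx)(1 - r²q·qx)` is `θ*_i -
θ*_0` up to the factor `q^i / h*`, and the last two factors of the denominator form `q^i N_i`. -/
theorem qQuotient_sub_first {q h s r D x : F} (hq : q ≠ 0) (hq1 : q - 1 ≠ 0) (hD : D ≠ 0)
    (hx : x ≠ 0) (h1 : 1 + r * q ≠ 0) (h2 : 1 + r * q * x ≠ 0) (h3 : 1 + r * q * (q * x) ≠ 0) :
    h * (1 - q * x) * (1 - s * (q * x * q)) / (q * x) + qQuotient q h s r D x -
        qQuotient q h s r D (q * x) + qQuotient q h s r D 1 =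
      -(h * (1 + s * q * D) * (1 + r * q * D) * (1 - q * x) * (1 - r ^ 2 * q * (q * x)) /
        (D * (1 + r * q) * (1 + r * q * x) * (1 + r * q * (q * x)))) := by
  -- The factors of the denominators become atoms, which `field_simp` clears as they stand; they are
  -- expanded again for `ring`.
  obtain ⟨k, hk⟩ : ∃ k, k = q - 1 := ⟨_, rfl⟩
  obtain ⟨v, hv⟩ : ∃ v, v = 1 + r * q * x := ⟨_, rfl⟩
  obtain ⟨w, hw⟩ : ∃ w, w = 1 + r * q * (q * x) := ⟨_, rfl⟩
  obtain ⟨u, hu⟩ : ∃ u, u = 1 + r * q := ⟨_, rfl⟩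
  simp only [qQuotient, mul_one, one_mul, ← hk, ← hu, ← hv, ← hw] at hq1 h1 h2 h3 ⊢
  field_simp
  rw [hk, hu, hv, hw]
  ring

/-- The counterpart for `a_i - a_d`, with `E = q^{d-1}`: the numerator now contains `θ*_i - θ*_d` up
to the same factor `q^i / h*`, over the same `q^i N_i`. -/
theorem qQuotient_sub_last {q h s r E x : F} (hq : q ≠ 0) (hq1 : q - 1 ≠ 0) (hE : E ≠ 0)
    (hx : x ≠ 0) (h2 : 1 + r * q * x ≠ 0) (h3 : 1 + r * q * (q * x) ≠ 0)
    (h4 : 1 + r * q * E ≠ 0) :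
    h * (1 - q * x) * (1 - s * (q * x * q)) / (q * x) + qQuotient q h s r (q * E) x -
        qQuotient q h s r (q * E) (q * x) -
        (h * (1 - q * E) * (1 - s * (q * E * q)) / (q * E) + qQuotient q h s r (q * E) E) =
      -(h * (1 + s * q * (q * E)) * (1 + r) * (1 - x / E) * (1 - r ^ 2 * q * (q * x) * (q * E)) /
        ((1 + r * q * E) * (1 + r * q * x) * (1 + r * q * (q * x)))) := by
  obtain ⟨k, hk⟩ : ∃ k, k = q - 1 := ⟨_, rfl⟩
  obtain ⟨v, hv⟩ : ∃ v, v = 1 + r * q * x := ⟨_, rfl⟩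
  obtain ⟨w, hw⟩ : ∃ w, w = 1 + r * q * (q * x) := ⟨_, rfl⟩
  obtain ⟨u, hu⟩ : ∃ u, u = 1 + r * q * E := ⟨_, rfl⟩
  simp only [qQuotient, ← hk, ← hu, ← hv, ← hw] at hq1 h2 h3 h4 ⊢
  field_simp
  rw [hk, hu, hv, hw]
  ring

/-- Division-free form of `qQuotient`. -/
theorem qQuotient_mul {q h hs s r D x : F} (hq : q ≠ 0) (hD : D ≠ 0) (hx : x ≠ 0)
    (hq1 : q - 1 ≠ 0) (h2 : 1 + r * q * x ≠ 0) :
    h * hs * (q / (q * x) ^ 2) * (1 - q * x) * (1 - q * x / (D * q)) * (1 - r * (q * x)) *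
        (1 - s * r * D * q * (q * x)) =
      qQuotient q h s r D x * (hs * (1 - q * x) * (1 - r ^ 2 * (q * x * q)) / (q * x) -
        hs * (1 - x) * (1 - r ^ 2 * (x * q)) / x) := by
  obtain ⟨k, hk⟩ : ∃ k, k = q - 1 := ⟨_, rfl⟩
  obtain ⟨v, hv⟩ : ∃ v, v = 1 + r * q * x := ⟨_, rfl⟩
  have hg : hs * (1 - q * x) * (1 - r ^ 2 * (q * x * q)) / (q * x) -
      hs * (1 - x) * (1 - r ^ 2 * (x * q)) / x = -(hs * k * v * (1 - r * (q * x)) / (q * x)) := by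
    rw [hk, hv]
    field_simp
    ring
  rw [hg]
  simp only [qQuotient, ← hk, ← hv] at hq1 h2 ⊢
  field_simp

/-- Treats three types at once. For `s* = r²` the second root in the `q`-Racah split sequence is `s
r q^{d+1}`; `s = 0` gives `q`-Hahn and `r = 0` dual `q`-Krawtchouk. Here `N_i = (1 + r q^i)(1 + r
q^{i+1}) / q^i`. -/
theorem combination_of_q_form [FiniteDimensional F V] (Φ : LeonardSystem F V d)
    (hd : 2 ≤ d) {q h hs s r : F} (hq : q ≠ 0)
    (hf : ∀ i : Fin (d + 1), Φ.th i = Φ.th 0 +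
      h * (1 - q ^ (i : ℕ)) * (1 - s * q ^ ((i : ℕ) + 1)) * q ^ (-((i : ℕ) : ℤ)))
    (hg : ∀ i : Fin (d + 1), Φ.ths i = Φ.ths 0 +
      hs * (1 - q ^ (i : ℕ)) * (1 - r ^ 2 * q ^ ((i : ℕ) + 1)) * q ^ (-((i : ℕ) : ℤ)))
    (hp : ∀ i : ℕ, 1 ≤ i → i ≤ d → Φ.varphi i =
      h * hs * q ^ (1 - 2 * (i : ℤ)) * (1 - q ^ i) * (1 - q ^ ((i : ℤ) - d - 1)) *
        (1 - r * q ^ i) * (1 - s * r * q ^ (d + 1) * q ^ i)) :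
    Φ.IsNonzeroAndBasisIfDimOne (Φ.combination (q ^ d * (r + 1) * (r * q + 1))
      ((r * q ^ d + 1) * (r * q ^ (d + 1) + 1))) := by
  simp only [zpow_neg, zpow_natCast, ← div_eq_mul_inv, pow_succ q] at hf hg
  have hinj := fun i j => Φ.sub_ne_zero_of_ths_eq
    (g := fun i => hs * (1 - q ^ i) * (1 - r ^ 2 * (q ^ i * q)) / q ^ i) hg (i := i) (j := j)
  have hx : ∀ i : ℕ, q ^ i ≠ 0 := fun i => pow_ne_zero i hq
  -- With `s* = r²` the difference of consecutive dual eigenvalues splits into linear factors, none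
  -- of which can vanish.
  have hdiff : ∀ i : ℕ, i + 1 ≤ d → q - 1 ≠ 0 ∧ 1 + r * q * q ^ i ≠ 0 := fun i hi => by
    have key := hinj (i + 1) i hi (by omega) (by omega)
    have hi0 := hx i
    have : hs * (1 - q ^ (i + 1)) * (1 - r ^ 2 * (q ^ (i + 1) * q)) / q ^ (i + 1) -
        hs * (1 - q ^ i) * (1 - r ^ 2 * (q ^ i * q)) / q ^ i =
        -(hs * (q - 1) * (1 + r * q * q ^ i) * (1 - r * (q * q ^ i)) / (q * q ^ i)) := by
      rw [pow_succ']
      field_simp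
      ring
    rw [this] at key
    refine ⟨fun h => key ?_, fun h => key ?_⟩ <;> simp [h]
  have hq1 := (hdiff 0 (by omega)).1
  have hr0 := (hdiff 0 (by omega)).2
  obtain ⟨e, rfl⟩ : ∃ e, d = e + 1 := ⟨d - 1, by omega⟩
  have hre := (hdiff e (by omega)).2
  refine Φ.combination_isNonzeroAndBasis_of_eq hd ?_
    (fun i => h * (1 - q ^ i) * (1 - s * (q ^ i * q)) / q ^ i)
    (fun i => hs * (1 - q ^ i) * (1 - r ^ 2 * (q ^ i * q)) / q ^ i)
    (fun i => qQuotient q h s r (q ^ (e + 1)) (q ^ (i - 1))) hf hg (fun i hi => ?_)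
    (fun n hn => ?_)
  -- If both coefficients vanish, then `r = -1` and `q^{d+1} = 1`, which forces `θ*_d = θ*_0`.
  · by_contra! h0
    have h1 : r * q ^ (e + 1) + 1 ≠ 0 := fun h => hre (by rw [← h]; ring)
    have h2 : r * q + 1 ≠ 0 := fun h => hr0 (by rw [← h]; ring)
    have h3 := (mul_eq_zero.1 h0.2).resolve_left h1
    have h4 := (mul_eq_zero.1 ((mul_eq_zero.1 h0.1).resolve_right h2)).resolve_left (hx _)
    have hr : r = -1 := eq_neg_of_add_eq_zero_left h4
    refine hinj (e + 1) 0 le_rfl (by omega) (by omega) ?_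
    have h5 : q ^ (e + 1) * q = 1 := by
      rw [hr, pow_succ] at h3
      linear_combination -h3
    simp [hr, h5]
  · have hz1 : q ^ (1 - 2 * ((i + 1 : ℕ) : ℤ)) = q / (q * q ^ i) ^ 2 := by
      rw [zpow_sub₀ hq, zpow_one, zpow_mul', ← pow_succ']
      norm_cast
    have hz2 : q ^ (((i + 1 : ℕ) : ℤ) - (e + 1 : ℕ) - 1) = q * q ^ i / (q ^ (e + 1) * q) := by
      rw [zpow_sub₀ hq, zpow_sub₀ hq, zpow_one, zpow_natCast, zpow_natCast, pow_succ' q i, div_div]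
    rw [hp _ (by omega) hi, hz1, hz2]
    simp only [Nat.add_sub_cancel, pow_succ' q i, pow_succ q (e + 1)]
    rw [← qQuotient_mul hq (hx _) (hx i) hq1 (hdiff i hi).2]
    ring
  · have h3 := (hdiff (n + 1) (by omega)).2
    have h2 := (hdiff n (by omega)).2
    rw [pow_zero, mul_one] at hr0
    rw [pow_succ'] at h3
    have hE := hx e
    have hxn := hx n
    -- After these factorizations both sides have the same dependence on `n`; the coefficients
    -- balance the remaining constants.
    have e1 := qQuotient_sub_first (h := h) (s := s) hq hq1 (hx (e + 1)) hxn hr0 h2 h3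
    have e2 := qQuotient_sub_last (h := h) (s := s) hq hq1 hE hxn h2 h3 hre
    simp only [Nat.add_sub_cancel, show n + 2 - 1 = n + 1 from rfl, Nat.sub_self, pow_zero,
      pow_succ' q n, pow_succ q (e + 1)] at e1 ⊢
    rw [e1]
    simp only [pow_succ' q e] at e2 ⊢
    rw [e2]
    generalize q ^ n = x at *
    generalize q ^ e = E at *
    obtain ⟨t, ht⟩ : ∃ t, t = 1 + r * q * E := ⟨_, rfl⟩
    obtain ⟨u, hu⟩ : ∃ u, u = 1 + r * q := ⟨_, rfl⟩
    obtain ⟨v, hv⟩ : ∃ v, v = 1 + r * q * x := ⟨_, rfl⟩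
    obtain ⟨w, hw⟩ : ∃ w, w = 1 + r * q * (q * x) := ⟨_, rfl⟩
    have ht' : r * (q * E) + 1 = t := by rw [ht]; ring
    have hu' : r * q + 1 = u := by rw [hu]; ring
    rw [← ht] at hre
    rw [← hu] at hr0
    rw [← hv] at h2
    rw [← hw] at h3
    simp only [ht', hu', ← ht, ← hu, ← hv, ← hw]
    field_simp
    ring

/-! ### Racah, Hahn and Krawtchouk types -/

/-- For `s* = 2r` one has `θ*_i - θ*_{i-1} = 2h*(i + r)`, which cancels a factor of the split
parameter. So `c_i` is a cubic polynomial in `i`, and `a_i` turns out to be affine in `θ*_i`. -/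
theorem combination_of_racah_form [FiniteDimensional F V] (Φ : LeonardSystem F V d) (hd : 2 ≤ d)
    {h hs s r r' : F} (hr : r' = s + r + d + 1)
    (hf : ∀ i : Fin (d + 1), Φ.th i = Φ.th 0 + h * (i : ℕ) * ((i : ℕ) + 1 + s))
    (hg : ∀ i : Fin (d + 1), Φ.ths i = Φ.ths 0 + hs * (i : ℕ) * ((i : ℕ) + 1 + 2 * r))
    (hp : ∀ i : ℕ, 1 ≤ i → i ≤ d →
      Φ.varphi i = h * hs * i * (i - d - 1) * (i + r) * (i + r')) :
    Φ.IsNonzeroAndBasisIfDimOne (Φ.combination 1 1) := by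
  -- `2` is a factor of `θ*_1 - θ*_0 = 2h*(1 + r)`.
  have h2 : (2 : F) ≠ 0 := fun h2 => by
    refine Φ.sub_ne_zero_of_ths_eq (g := fun i => hs * i * (i + 1 + 2 * r)) hg
      (show 1 ≤ d by omega) (Nat.zero_le d) one_ne_zero ?_
    push_cast
    linear_combination (hs * (1 + r)) * h2
  refine Φ.combination_isNonzeroAndBasis_of_eq hd (Or.inl one_ne_zero)
    (fun i => h * i * (i + 1 + s)) (fun i => hs * i * (i + 1 + 2 * r))
    (fun i => h * i * (i - d - 1) * (i + r') / 2) hf hg (fun i hi => ?_) (fun n hn => ?_)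
  · rw [hp _ (by omega) hi]
    push_cast
    field_simp
    ring
  · subst hr
    push_cast
    field_simp
    ring

/-- Here `N_i = (s* + 2i)(s* + 2i + 2) = 4i(i + 1 + s*) + N_0`. The linear growth of `c_i - c_{i+1}`
cancels `s i`, leaving a constant plus a multiple of `1 / N_i`. -/
theorem combination_of_hahn_form [FiniteDimensional F V] (Φ : LeonardSystem F V d) (hd : 2 ≤ d)
    {hs s ss r : F}
    (hf : ∀ i : Fin (d + 1), Φ.th i = Φ.th 0 + s * (i : ℕ))
    (hg : ∀ i : Fin (d + 1), Φ.ths i = Φ.ths 0 + hs * (i : ℕ) * ((i : ℕ) + 1 + ss))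
    (hp : ∀ i : ℕ, 1 ≤ i → i ≤ d → Φ.varphi i = hs * s * i * (i - d - 1) * (i + r)) :
    Φ.IsNonzeroAndBasisIfDimOne (Φ.combination (ss * (ss + 2))
      ((ss + 2 * d) * (ss + 2 * d + 2))) := by
  have hinj := fun i j => Φ.sub_ne_zero_of_ths_eq (g := fun i => hs * i * (i + 1 + ss)) hg
    (i := i) (j := j)
  have hne : ∀ i : ℕ, i + 1 ≤ d → ss + 2 * (i + 1) ≠ 0 := fun i hi h0 => by
    refine hinj (i + 1) i hi (by omega) (by omega) ?_
    push_cast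
    linear_combination hs * h0
  refine Φ.combination_isNonzeroAndBasis_of_eq hd ?_
    (fun i => s * i) (fun i => hs * i * (i + 1 + ss))
    (fun i => s * i * (i - d - 1) * (i + r) / (ss + 2 * i)) hf hg (fun i hi => ?_)
    (fun n hn => ?_)
  -- The factors `s* + 2` and `s* + 2d` are nonzero, so `s* = 0` and `d + 1 = 0` in `F`, whence
  -- `θ*_d = θ*_0`.
  · by_contra! h0
    have h1 := hne 0 (by omega)
    have h2 := hne (d - 1) (by omega)
    rw [← Nat.cast_one (R := F), ← Nat.cast_add, Nat.sub_add_cancel (by omega)] at h2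
    have hss : ss = 0 := (mul_eq_zero.1 h0.1).resolve_right (fun h => h1 (by simpa using h))
    have h3 := (mul_eq_zero.1 h0.2).resolve_left h2
    have h4 : (2 : F) ≠ 0 := fun h => h1 (by rw [hss]; simpa using h)
    have h5 : (d : F) + 1 = 0 := mul_left_cancel₀ h4 (by linear_combination h3 - hss)
    refine hinj d 0 le_rfl (by omega) (by omega) ?_
    push_cast
    linear_combination hs * d * (h5 + hss)
  · rw [hp _ (by omega) hi]
    have := hne i hi
    push_cast
    rw [div_mul_eq_mul_div, eq_div_iff this]
    ring
  · obtain ⟨e, rfl⟩ : ∃ e, d = e + 1 := ⟨d - 1, by omega⟩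
    have h1 := hne 0 (by omega)
    have h2 := hne e (by omega)
    have h3 := hne n (by omega)
    have h4 := hne (n + 1) (by omega)
    push_cast at h1 h2 h3 h4 ⊢
    rw [zero_add, mul_one] at h1
    have h4' : ss + 2 * ((n : F) + 2) ≠ 0 := by
      convert h4 using 2
      ring
    simp only [mul_one]
    field_simp
    ring

/-- Now `c_i` is quadratic in `i`, so `a_i` is affine in `i` and hence in `θ*_i`. -/
theorem combination_of_krawtchouk_form [FiniteDimensional F V] (Φ : LeonardSystem F V d)
    (hd : 2 ≤ d) {s ss r : F} (hss : ss ≠ 0)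
    (hf : ∀ i : Fin (d + 1), Φ.th i = Φ.th 0 + s * (i : ℕ))
    (hg : ∀ i : Fin (d + 1), Φ.ths i = Φ.ths 0 + ss * (i : ℕ))
    (hp : ∀ i : ℕ, 1 ≤ i → i ≤ d → Φ.varphi i = r * i * (i - d - 1)) :
    Φ.IsNonzeroAndBasisIfDimOne (Φ.combination 1 1) := by
  refine Φ.combination_isNonzeroAndBasis_of_eq hd (Or.inl one_ne_zero)
    (fun i => s * i) (fun i => ss * i) (fun i => r * i * (i - d - 1) / ss) hf hg
    (fun i hi => ?_) (fun n hn => ?_)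
  · rw [hp _ (by omega) hi]
    push_cast
    field_simp
    ring
  · push_cast
    field_simp
    ring

/-! ### Bannai/Ito type -/

/-- For `s* = -2r` consecutive dual eigenvalues differ by `±4h*(i + 1 + r)`. -/
theorem add_cast_ne_zero_of_bannaiIto (Φ : LeonardSystem F V d) {hs ss r : F} (hr : ss = -2 * r)
    (hg : ∀ i : Fin (d + 1), Φ.ths i = Φ.ths 0 +
      hs * (ss - 1 + (1 - ss + 2 * (i : ℕ)) * (-1) ^ (i : ℕ)))
    {i : ℕ} (hi : i + 1 ≤ d) : (i : F) + 1 + r ≠ 0 := by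
  intro h0
  refine Φ.sub_ne_zero_of_ths_eq (g := fun i => hs * (ss - 1 + (1 - ss + 2 * i) * (-1) ^ i)) hg
    hi (show i ≤ d by omega) (by omega) ?_
  push_cast
  rw [hr, pow_succ]
  linear_combination (-(4 * hs * (-1) ^ i)) * h0

/-- Splits the scalar identity by the parity of the index, with `cEven` and `cOdd` the two branches
of `c_i`. The values of `f`, `g`, `c` at `d` stay unevaluated, since the parity of `d` is fixed only
by the caller. -/
theorem combination_of_bannaiIto_form [FiniteDimensional F V] (Φ : LeonardSystem F V d)
    (hd : 2 ≤ d) {h hs s ss r α β : F} {cEven cOdd : ℕ → F} (hr : ss = -2 * r)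
    (hαβ : α ≠ 0 ∨ β ≠ 0)
    (hf : ∀ i : Fin (d + 1), Φ.th i = Φ.th 0 +
      h * (s - 1 + (1 - s + 2 * (i : ℕ)) * (-1) ^ (i : ℕ)))
    (hg : ∀ i : Fin (d + 1), Φ.ths i = Φ.ths 0 +
      hs * (ss - 1 + (1 - ss + 2 * (i : ℕ)) * (-1) ^ (i : ℕ)))
    (hpe : ∀ i : ℕ, 1 ≤ i → i ≤ d → Even i → Φ.varphi i = cEven i * (4 * hs * (i + r)))
    (hpo : ∀ i : ℕ, 1 ≤ i → i ≤ d → Odd i → Φ.varphi i = cOdd i * -(4 * hs * (i + r)))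
    (f g c : ℕ → F) (hfd : f = fun i : ℕ => if Even i then 2 * h * i else 2 * h * (s - 1 - i))
    (hgd : g = fun i : ℕ => if Even i then 2 * hs * i else -(2 * hs * (2 * r + 1 + i)))
    (hcd : c = fun i : ℕ => if Even i then cEven i else cOdd i)
    (hme : ∀ n : ℕ, n + 1 < d → Even (n + 1) →
      α * ((2 * h * (n + 1) + cEven (n + 1) - cOdd (n + 2) + cOdd 1) *
        (2 * hs * (n + 1) - g d)) =
      β * ((2 * h * (n + 1) + cEven (n + 1) - cOdd (n + 2) - (f d + c d)) * (2 * hs * (n + 1))))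
    (hmo : ∀ n : ℕ, n + 1 < d → Odd (n + 1) →
      α * ((2 * h * (s - 1 - (n + 1)) + cOdd (n + 1) - cEven (n + 2) + cOdd 1) *
        (-(2 * hs * (2 * r + 1 + (n + 1))) - g d)) =
      β * ((2 * h * (s - 1 - (n + 1)) + cOdd (n + 1) - cEven (n + 2) - (f d + c d)) *
        -(2 * hs * (2 * r + 1 + (n + 1))))) :
    Φ.IsNonzeroAndBasisIfDimOne (Φ.combination α β) := by
  refine Φ.combination_isNonzeroAndBasis_of_eq hd hαβ f g c (fun i => ?_) (fun i => ?_)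
    (fun i hi => ?_) (fun n hn => ?_)
  · rw [hf i, hfd]
    rcases Nat.even_or_odd (i : ℕ) with hi | hi
    · rw [hi.neg_one_pow]
      simp only [hi, if_true]
      ring
    · rw [hi.neg_one_pow]
      simp only [Nat.not_even_iff_odd.2 hi, if_false]
      ring
  · rw [hg i, hgd, hr]
    rcases Nat.even_or_odd (i : ℕ) with hi | hi
    · rw [hi.neg_one_pow]
      simp only [hi, if_true]
      ring
    · rw [hi.neg_one_pow]
      simp only [Nat.not_even_iff_odd.2 hi, if_false]
      ring
  · rcases Nat.even_or_odd i with he | ho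
    · have h1 : ¬ Even (i + 1) := Nat.even_add_one.not.2 (not_not.2 he)
      rw [hpo _ (by omega) hi (Nat.not_even_iff_odd.1 h1), hcd, hgd]
      simp only [he, h1, if_true, if_false]
      push_cast
      ring
    · have h1 : Even (i + 1) := ho.add_one
      rw [hpe _ (by omega) hi h1, hcd, hgd]
      simp only [Nat.not_even_iff_odd.2 ho, h1, if_true, if_false]
      push_cast
      ring
  · have h1 : ¬ Even 1 := Nat.not_even_one
    have e1 : c 1 = cOdd 1 := by simp [hcd]
    rcases Nat.even_or_odd (n + 1) with he | ho
    · have h2 : ¬ Even (n + 2) := Nat.even_add_one.not.2 (not_not.2 he)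
      have e2 : f (n + 1) = 2 * h * (n + 1) := by simp [hfd, he]
      have e3 : g (n + 1) = 2 * hs * (n + 1) := by simp [hgd, he]
      have e4 : c (n + 1) = cEven (n + 1) := by simp only [hcd, he, if_true]
      have e5 : c (n + 2) = cOdd (n + 2) := by simp only [hcd, h2, if_false]
      rw [e1, e2, e3, e4, e5]
      exact hme n hn he
    · have h2 : Even (n + 2) := ho.add_one
      have h3 := Nat.not_even_iff_odd.2 ho
      have e2 : f (n + 1) = 2 * h * (s - 1 - (n + 1)) := by
        simp only [hfd, h3, if_false]
        push_cast
        ring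
      have e3 : g (n + 1) = -(2 * hs * (2 * r + 1 + (n + 1))) := by
        simp only [hgd, h3, if_false]
        push_cast
        ring
      have e4 : c (n + 1) = cOdd (n + 1) := by simp only [hcd, h3, if_false]
      have e5 : c (n + 2) = cEven (n + 2) := by simp only [hcd, h2, if_true]
      rw [e1, e2, e3, e4, e5]
      exact hmo n hn ho

theorem cast_ne_zero_of_bannaiIto (Φ : LeonardSystem F V d) {hs ss : F} (hd : 0 < d)
    (hde : Even d)
    (hg : ∀ i : Fin (d + 1), Φ.ths i = Φ.ths 0 +
      hs * (ss - 1 + (1 - ss + 2 * (i : ℕ)) * (-1) ^ (i : ℕ))) : (d : F) ≠ 0 := by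
  intro h0
  refine Φ.sub_ne_zero_of_ths_eq (g := fun i => hs * (ss - 1 + (1 - ss + 2 * i) * (-1) ^ i)) hg
    le_rfl (Nat.zero_le d) hd.ne' ?_
  simp [hde.neg_one_pow, h0]

/-- The factor `i + r` cancels in `c_i` for even `i` only. Accordingly `N_i` is `i + 1 + r` for even
`i` and `-(i + r)` for odd `i`. -/
theorem combination_of_bannaiIto_even_first [FiniteDimensional F V] (Φ : LeonardSystem F V d)
    (hd : 2 ≤ d) (hde : Even d) {h hs s ss r r' : F} (hr : ss = -2 * r) (hr' : r' = -s + r + d + 1)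
    (hf : ∀ i : Fin (d + 1), Φ.th i = Φ.th 0 +
      h * (s - 1 + (1 - s + 2 * (i : ℕ)) * (-1) ^ (i : ℕ)))
    (hg : ∀ i : Fin (d + 1), Φ.ths i = Φ.ths 0 +
      hs * (ss - 1 + (1 - ss + 2 * (i : ℕ)) * (-1) ^ (i : ℕ)))
    (hpe : ∀ i : ℕ, 1 ≤ i → i ≤ d → Even i → Φ.varphi i = -4 * h * hs * i * (i + r))
    (hpo : ∀ i : ℕ, 1 ≤ i → i ≤ d → Odd i →
      Φ.varphi i = -4 * h * hs * (i - d - 1) * (i + r')) :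
    Φ.IsNonzeroAndBasisIfDimOne (Φ.combination (r + 1) (r + d + 1)) := by
  have hne := fun i => Φ.add_cast_ne_zero_of_bannaiIto hr hg (i := i)
  refine Φ.combination_of_bannaiIto_form hd (cEven := fun i => -h * i)
    (cOdd := fun i => h * (i - d - 1) * (i + r') / (i + r)) hr ?_ hf hg
    (fun i h1 h2 h3 => ?_) (fun i h1 h2 h3 => ?_) _ _ _ rfl rfl rfl (fun n hn hpar => ?_)
    (fun n hn hpar => ?_)
  -- The coefficients differ by `d`, and `θ*_d - θ*_0 = 2h*d`.
  · by_contra! h0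
    exact Φ.cast_ne_zero_of_bannaiIto (by omega) hde hg (by linear_combination h0.2 - h0.1)
  · rw [hpe i h1 h2 h3]
    ring
  · obtain ⟨j, rfl⟩ : ∃ j, i = j + 1 := ⟨i - 1, by omega⟩
    have := hne j h2
    rw [hpo _ h1 h2 h3]
    push_cast
    rw [mul_neg, div_mul_eq_mul_div, ← neg_div, eq_div_iff this]
    ring
  · have h1 := hne 0 (by omega)
    have h2 := hne (n + 1) (by omega)
    simp only [hde, if_true]
    push_cast at h1 h2 ⊢
    obtain ⟨u, hu⟩ : ∃ u, u = 1 + r := ⟨_, rfl⟩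
    obtain ⟨v, hv⟩ : ∃ v, v = (n : F) + 2 + r := ⟨_, rfl⟩
    rw [zero_add, ← hu] at h1
    rw [show (n : F) + 1 + 1 + r = v by rw [hv]; ring] at h2
    rw [← hu, ← hv]
    field_simp
    rw [hu, hv, hr']
    ring
  · have h1 := hne 0 (by omega)
    have h2 := hne n (by omega)
    simp only [hde, if_true]
    push_cast at h1 h2 ⊢
    obtain ⟨u, hu⟩ : ∃ u, u = 1 + r := ⟨_, rfl⟩
    obtain ⟨v, hv⟩ : ∃ v, v = (n : F) + 1 + r := ⟨_, rfl⟩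
    rw [zero_add, ← hu] at h1
    rw [← hv] at h2
    rw [← hu, ← hv]
    field_simp
    rw [hu, hv, hr']
    ring

/-- Now `i + r` cancels for odd `i` only, and `N_i` is `i + r` for even `i` and `-(i + 1 + r)` for
odd `i`. -/
theorem combination_of_bannaiIto_even_second [FiniteDimensional F V] (Φ : LeonardSystem F V d)
    (hd : 2 ≤ d) (hde : Even d) {h hs s ss r r' : F} (hr : ss = -2 * r) (hr' : r' = -s + r + d + 1)
    (hf : ∀ i : Fin (d + 1), Φ.th i = Φ.th 0 +
      h * (s - 1 + (1 - s + 2 * (i : ℕ)) * (-1) ^ (i : ℕ)))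
    (hg : ∀ i : Fin (d + 1), Φ.ths i = Φ.ths 0 +
      hs * (ss - 1 + (1 - ss + 2 * (i : ℕ)) * (-1) ^ (i : ℕ)))
    (hpe : ∀ i : ℕ, 1 ≤ i → i ≤ d → Even i → Φ.varphi i = -4 * h * hs * i * (i + r'))
    (hpo : ∀ i : ℕ, 1 ≤ i → i ≤ d → Odd i →
      Φ.varphi i = -4 * h * hs * (i - d - 1) * (i + r)) :
    Φ.IsNonzeroAndBasisIfDimOne (Φ.combination r (r + d)) := by
  have hne := fun i => Φ.add_cast_ne_zero_of_bannaiIto hr hg (i := i)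
  refine Φ.combination_of_bannaiIto_form hd (cEven := fun i => -(h * i * (i + r') / (i + r)))
    (cOdd := fun i => h * (i - d - 1)) hr ?_ hf hg
    (fun i h1 h2 h3 => ?_) (fun i h1 h2 h3 => ?_) _ _ _ rfl rfl rfl (fun n hn hpar => ?_)
    (fun n hn hpar => ?_)
  · by_contra! h0
    exact Φ.cast_ne_zero_of_bannaiIto (by omega) hde hg (by linear_combination h0.2 - h0.1)
  · obtain ⟨j, rfl⟩ : ∃ j, i = j + 1 := ⟨i - 1, by omega⟩
    have := hne j h2
    rw [hpe _ h1 h2 h3]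
    push_cast
    rw [neg_mul (_ / _), div_mul_eq_mul_div, ← neg_div, eq_div_iff this]
    ring
  · rw [hpo i h1 h2 h3]
    ring
  · obtain ⟨e, rfl⟩ : ∃ e, d = e + 1 := ⟨d - 1, by omega⟩
    have h1 := hne e (by omega)
    have h2 := hne n (by omega)
    simp only [hde, if_true]
    push_cast at h1 h2 ⊢
    obtain ⟨u, hu⟩ : ∃ u, u = (e : F) + 1 + r := ⟨_, rfl⟩
    obtain ⟨v, hv⟩ : ∃ v, v = (n : F) + 1 + r := ⟨_, rfl⟩
    rw [← hu] at h1
    rw [← hv] at h2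
    rw [← hu, ← hv]
    field_simp
    rw [hu, hv, hr']
    push_cast
    ring
  · obtain ⟨e, rfl⟩ : ∃ e, d = e + 1 := ⟨d - 1, by omega⟩
    have h1 := hne e (by omega)
    have h2 := hne (n + 1) (by omega)
    simp only [hde, if_true]
    push_cast at h1 h2 ⊢
    obtain ⟨u, hu⟩ : ∃ u, u = (e : F) + 1 + r := ⟨_, rfl⟩
    obtain ⟨v, hv⟩ : ∃ v, v = (n : F) + 2 + r := ⟨_, rfl⟩
    rw [← hu] at h1
    rw [show (n : F) + 1 + 1 + r = v by rw [hv]; ring] at h2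
    rw [← hu, ← hv]
    field_simp
    rw [hu, hv, hr']
    push_cast
    ring

/-- Again `N_i` is `i + r` for even `i` and `-(i + 1 + r)` for odd `i`; as `d` is odd, `N_d` carries
the minus sign of the second coefficient. -/
theorem combination_of_bannaiIto_odd [FiniteDimensional F V] (Φ : LeonardSystem F V d)
    (hd : 2 ≤ d) (hdo : Odd d) {h hs s ss r r' : F} (hr : ss = -2 * r) (hr' : r' = -s + r + d + 1)
    (hf : ∀ i : Fin (d + 1), Φ.th i = Φ.th 0 +
      h * (s - 1 + (1 - s + 2 * (i : ℕ)) * (-1) ^ (i : ℕ)))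
    (hg : ∀ i : Fin (d + 1), Φ.ths i = Φ.ths 0 +
      hs * (ss - 1 + (1 - ss + 2 * (i : ℕ)) * (-1) ^ (i : ℕ)))
    (hpe : ∀ i : ℕ, 1 ≤ i → i ≤ d → Even i → Φ.varphi i = -4 * h * hs * i * (i - d - 1))
    (hpo : ∀ i : ℕ, 1 ≤ i → i ≤ d → Odd i →
      Φ.varphi i = -4 * h * hs * (i + r) * (i + r')) :
    Φ.IsNonzeroAndBasisIfDimOne (Φ.combination r (-(r + d + 1))) := by
  have hne := fun i => Φ.add_cast_ne_zero_of_bannaiIto hr hg (i := i)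
  have hde : ¬ Even d := Nat.not_even_iff_odd.2 hdo
  refine Φ.combination_of_bannaiIto_form hd
    (cEven := fun i => -(h * i * (i - d - 1) / (i + r)))
    (cOdd := fun i => h * (i + r')) hr ?_ hf hg
    (fun i h1 h2 h3 => ?_) (fun i h1 h2 h3 => ?_) _ _ _ rfl rfl rfl (fun n hn hpar => ?_)
    (fun n hn hpar => ?_)
  -- The coefficients differ by `2r + d + 1`, a factor of `θ*_d - θ*_0`.
  · by_contra! h0
    refine Φ.sub_ne_zero_of_ths_eq (g := fun i => hs * (ss - 1 + (1 - ss + 2 * i) * (-1) ^ i)) hg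
      le_rfl (Nat.zero_le d) (by omega) ?_
    simp only [hdo.neg_one_pow, hr, pow_zero]
    push_cast
    linear_combination 2 * hs * h0.2 - 2 * hs * h0.1
  · obtain ⟨j, rfl⟩ : ∃ j, i = j + 1 := ⟨i - 1, by omega⟩
    have := hne j h2
    rw [hpe _ h1 h2 h3]
    push_cast
    rw [neg_mul (_ / _), div_mul_eq_mul_div, ← neg_div, eq_div_iff this]
    ring
  · rw [hpo i h1 h2 h3]
    ring
  · have h2 := hne n (by omega)
    simp only [hde, if_false]
    push_cast
    obtain ⟨v, hv⟩ : ∃ v, v = (n : F) + 1 + r := ⟨_, rfl⟩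
    rw [← hv] at h2 ⊢
    field_simp
    rw [hv, hr']
    ring
  · have h2 := hne (n + 1) (by omega)
    simp only [hde, if_false]
    push_cast at h2 ⊢
    obtain ⟨v, hv⟩ : ∃ v, v = (n : F) + 2 + r := ⟨_, rfl⟩
    rw [show (n : F) + 1 + 1 + r = v by rw [hv]; ring] at h2
    rw [← hv]
    field_simp
    rw [hv, hr']
    ring

end LeonardSystem

/-! ### The types as instances of these forms -/

theorem proposition12p1 {F V : Type*} [Field F] [IsAlgClosed F] [AddCommGroup V] [Module F V]
    [FiniteDimensional F V] {d : ℕ} (hd : 3 ≤ d) (Φ : LeonardSystem F V d) (hZ : Φ.Z ≠ ⊥) :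
    -- q-Racah
    (∀ q h hs s ss r₁ r₂ : F, Φ.IsQRacah q h hs s ss r₁ r₂ → ss = r₁ ^ 2 →
      Φ.IsNonzeroAndBasisIfDimOne (Φ.combination (q ^ d * (r₁ + 1) * (r₁ * q + 1))
        ((r₁ * q ^ d + 1) * (r₁ * q ^ (d + 1) + 1)))) ∧
    (∀ q h hs s ss r₁ r₂ : F, Φ.IsQRacah q h hs s ss r₁ r₂ → ss = r₂ ^ 2 →
      Φ.IsNonzeroAndBasisIfDimOne (Φ.combination (q ^ d * (r₂ + 1) * (r₂ * q + 1))
        ((r₂ * q ^ d + 1) * (r₂ * q ^ (d + 1) + 1)))) ∧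
    -- q-Hahn
    (∀ q h hs ss r : F, Φ.IsQHahn q h hs ss r → ss = r ^ 2 →
      Φ.IsNonzeroAndBasisIfDimOne (Φ.combination (q ^ d * (r + 1) * (r * q + 1))
        ((r * q ^ d + 1) * (r * q ^ (d + 1) + 1)))) ∧
    -- dual q-Krawtchouk
    (∀ q h hs s : F, Φ.IsDualQKrawtchouk q h hs s →
      Φ.IsNonzeroAndBasisIfDimOne (Φ.combination (q ^ d) 1)) ∧
    -- Racah
    (∀ h hs s ss r₁ r₂ : F, Φ.IsRacah h hs s ss r₁ r₂ → ss = 2 * r₁ →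
      Φ.IsNonzeroAndBasisIfDimOne (Φ.combination 1 1)) ∧
    (∀ h hs s ss r₁ r₂ : F, Φ.IsRacah h hs s ss r₁ r₂ → ss = 2 * r₂ →
      Φ.IsNonzeroAndBasisIfDimOne (Φ.combination 1 1)) ∧
    -- Hahn
    (∀ hs s ss r : F, Φ.IsHahn hs s ss r →
      Φ.IsNonzeroAndBasisIfDimOne (Φ.combination (ss * (ss + 2))
        ((ss + 2 * d) * (ss + 2 * d + 2)))) ∧
    -- Krawtchouk
    (∀ s ss r : F, Φ.IsKrawtchouk s ss r →
      Φ.IsNonzeroAndBasisIfDimOne (Φ.combination 1 1)) ∧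
    -- Bannai/Ito, d even
    (∀ h hs s ss r₁ r₂ : F, Φ.IsBannaiIto h hs s ss r₁ r₂ → Even d → ss = -2 * r₁ →
      Φ.IsNonzeroAndBasisIfDimOne (Φ.combination (r₁ + 1) (r₁ + d + 1))) ∧
    (∀ h hs s ss r₁ r₂ : F, Φ.IsBannaiIto h hs s ss r₁ r₂ → Even d → ss = -2 * r₂ →
      Φ.IsNonzeroAndBasisIfDimOne (Φ.combination r₂ (r₂ + d))) ∧
    -- Bannai/Ito, d odd: here the second coefficient enters with the opposite sign
    (∀ h hs s ss r₁ r₂ : F, Φ.IsBannaiIto h hs s ss r₁ r₂ → Odd d → ss = -2 * r₁ →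
      Φ.IsNonzeroAndBasisIfDimOne (Φ.combination r₁ (-(r₁ + d + 1)))) ∧
    (∀ h hs s ss r₁ r₂ : F, Φ.IsBannaiIto h hs s ss r₁ r₂ → Odd d → ss = -2 * r₂ →
      Φ.IsNonzeroAndBasisIfDimOne (Φ.combination r₂ (-(r₂ + d + 1)))) := by
  have hd2 : 2 ≤ d := by omega
  refine ⟨?_, ?_, ?_, ?_, ?_, ?_, ?_, ?_, ?_, ?_, ?_, ?_⟩
  · rintro q h hs s ss r₁ r₂ ⟨⟨hq, -, -, -, -, hr₁, -⟩, hr, -, -, hth, hp⟩ rfl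
    have hr₂ : r₂ = s * r₁ * q ^ (d + 1) := mul_left_cancel₀ hr₁ (by rw [hr]; ring)
    refine Φ.combination_of_q_form hd2 hq (fun i => (hth i).1) (fun i => (hth i).2)
      (fun i h1 h2 => ?_)
    rw [(hp i h1 h2).1, hr₂]
  · rintro q h hs s ss r₁ r₂ ⟨⟨hq, -, -, -, -, -, hr₂⟩, hr, -, -, hth, hp⟩ rfl
    have hr₁ : r₁ = s * r₂ * q ^ (d + 1) := mul_right_cancel₀ hr₂ (by rw [hr]; ring)
    refine Φ.combination_of_q_form hd2 hq (fun i => (hth i).1) (fun i => (hth i).2)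
      (fun i h1 h2 => ?_)
    rw [(hp i h1 h2).1, hr₁]
    ring
  · rintro q h hs ss r ⟨⟨hq, -, -, -, -⟩, -, -, hth, hp⟩ rfl
    -- With `s = 0` the factor `1 - s r q^{d+1} q^i` is `1`.
    refine Φ.combination_of_q_form (h := h) (s := 0) hd2 hq (fun i => ?_) (fun i => (hth i).2)
      (fun i h1 h2 => ?_)
    · rw [(hth i).1]
      ring
    · rw [(hp i h1 h2).1]
      ring
  · rintro q h hs s ⟨⟨hq, -, -, -⟩, -, -, hth, hp⟩
    -- With `r = 0` one has `s* = 0`, and the coefficients reduce to `q^d` and `1`.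
    have := Φ.combination_of_q_form (h := h) (hs := hs) (s := s) (r := 0) hd2 hq
      (fun i => (hth i).1) (fun i => ?_) (fun i h1 h2 => ?_)
    · simpa using this
    · rw [(hth i).2]
      ring
    · rw [(hp i h1 h2).1]
      ring
  · rintro h hs s ss r₁ r₂ ⟨-, hr, -, -, -, hth, hp⟩ rfl
    exact Φ.combination_of_racah_form hd2 (r := r₁) (r' := r₂) (by linear_combination hr)
      (fun i => (hth i).1) (fun i => (hth i).2) (fun i h1 h2 => (hp i h1 h2).1)
  · rintro h hs s ss r₁ r₂ ⟨-, hr, -, -, -, hth, hp⟩ rfl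
    refine Φ.combination_of_racah_form hd2 (r := r₂) (r' := r₁) (by linear_combination hr)
      (fun i => (hth i).1) (fun i => (hth i).2) (fun i h1 h2 => ?_)
    rw [(hp i h1 h2).1]
    ring
  · rintro hs s ss r ⟨-, -, -, -, hth, hp⟩
    exact Φ.combination_of_hahn_form hd2 (fun i => (hth i).1) (fun i => (hth i).2)
      (fun i h1 h2 => (hp i h1 h2).1)
  · rintro s ss r ⟨⟨-, hss, -⟩, -, -, hth, hp⟩
    exact Φ.combination_of_krawtchouk_form hd2 hss (fun i => (hth i).1) (fun i => (hth i).2)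
      (fun i h1 h2 => (hp i h1 h2).1)
  · rintro h hs s ss r₁ r₂ ⟨-, -, hr, -, -, -, hth, hp⟩ hde hss
    exact Φ.combination_of_bannaiIto_even_first hd2 hde hss (r' := r₂)
      (by linear_combination hr - hss) (fun i => (hth i).1) (fun i => (hth i).2)
      (fun i h1 h2 h3 => ((hp i h1 h2).1 h3 hde).1)
      (fun i h1 h2 h3 => ((hp i h1 h2).2.1 h3 hde).1)
  · rintro h hs s ss r₁ r₂ ⟨-, -, hr, -, -, -, hth, hp⟩ hde hss
    exact Φ.combination_of_bannaiIto_even_second hd2 hde hss (r' := r₁)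
      (by linear_combination hr - hss) (fun i => (hth i).1) (fun i => (hth i).2)
      (fun i h1 h2 h3 => ((hp i h1 h2).1 h3 hde).1)
      (fun i h1 h2 h3 => ((hp i h1 h2).2.1 h3 hde).1)
  · rintro h hs s ss r₁ r₂ ⟨-, -, hr, -, -, -, hth, hp⟩ hdo hss
    exact Φ.combination_of_bannaiIto_odd hd2 hdo hss (r' := r₂)
      (by linear_combination hr - hss) (fun i => (hth i).1) (fun i => (hth i).2)
      (fun i h1 h2 h3 => ((hp i h1 h2).2.2.1 h3 hdo).1)
      (fun i h1 h2 h3 => ((hp i h1 h2).2.2.2 h3 hdo).1)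
  · rintro h hs s ss r₁ r₂ ⟨-, -, hr, -, -, -, hth, hp⟩ hdo hss
    refine Φ.combination_of_bannaiIto_odd hd2 hdo hss (r' := r₁)
      (by linear_combination hr - hss) (fun i => (hth i).1) (fun i => (hth i).2)
      (fun i h1 h2 h3 => ((hp i h1 h2).2.2.1 h3 hdo).1) (fun i h1 h2 h3 => ?_)
    rw [((hp i h1 h2).2.2.2 h3 hdo).1]
    ring
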